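/- Let $n\ge 3$. For $\alpha_0,\dots,\alpha_{n-2}$ in the open unit disk $\mathbb D$ and $\alpha_{n-1}\in S^1$ put $\rho_k=\sqrt{1-|\alpha_k|^2}$, $\Xi_k=\begin{bmatrix}\bar\alpha_k&\rho_k\\ \rho_k&-\alpha_k\end{bmatrix}$ for $0\le k\le n-2$, $\Xi_{-1}=[1]$, $\Xi_{n-1}=[\bar\alpha_{n-1}]$. The associated CMV matrix is the $n\times n$ unitary matrix $\mathcal C=\mathcal L\mathcal M$ with $\mathcal L=\operatorname{diag}(\Xi_0,\Xi_2,\dots)$ and $\mathcal M=\operatorname{diag}(\Xi_{-1},\Xi_1,\dots)$. Fix $\alpha_{n-1}\in S^1$ and let $M$ be the manifold of CMV matrices with this last coefficient (equivalently, with determinant $(-1)^{n-1}\bar\alpha_{n-1}$), on which $(\alpha_0,\dots,\alpha_{n-2})\in\mathbb D^{n-1}$ are coordinates. A matrix $\mathcal C\in M$ has $n$ distinct eigenvalues; on an open subset of $M$ label them continuously as $e^{i\theta_1},\dots,e^{i\theta_n}$, in any order, and let $\mu_j>0$ be the mass at $e^{i\theta_j}$ of the spectral measure of $\mathcal C$ and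 the vector $e_1=[1,0,\dots,0]^T$. The Ablowitz--Ladik bracket of functions of $\alpha_j=u_j+iv_j$, $0\le j\le n-2$, is $$\{f,g\}=\sum_{j=0}^{n-2}\rho_j^2\Bigl[\frac{\partial f}{\partial u_j}\frac{\partial g}{\partial v_j}-\frac{\partial f}{\partial v_j}\frac{\partial g}{\partial u_j}\Bigr].$$ The Gelfand--Dikij bracket of real functions $\phi,\psi$ on the space of all complex $n\times n$ matrices is $$\{\phi,\psi\}\big|_B=\tfrac12\langle R(XB),YB\rangle-\tfrac12\langle R(BX),BY\rangle,\qquad X=\nabla\phi|_B,\ Y=\nabla\psi|_B,$$ where $\langle X,Y\rangle=\operatorname{Im}\operatorname{tr}(XY)$, $\nabla\phi$ is the gradient with respect to this pairing, that is, $\frac{d}{dt}\big|_{t=0}\phi(B+tC)=\langle\nabla\phi|_B,C\rangle$, and $R(L+A)=L-A$ for $L$ lower triangular with real diagonal and $A$ anti-Hermitian. For functions on $M$ it is evaluated at a point of $M$ by means of extensions, differentiable at that point, to the space of all matrices. Then the functions $\log[\mu_2/\mu_1]$ and $\log[\mu_3/\mu_1]$ are smooth in $(\alpha_0,\dots,\alpha_{n-2})$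 and, near each point where they are defined, extend smoothly from $M$ to the space of all matrices; and for any labelling of the eigenvalues $$\bigl\{\log[\mu_2/\mu_1],\log[\mu_3/\mu_1]\bigr\}=2\cot\bigl(\tfrac{\theta_1-\theta_2}2\bigr)+2\cot\bigl(\tfrac{\theta_2-\theta_3}2\bigr)+2\cot\bigl(\tfrac{\theta_3-\theta_1}2\bigr)$$ both in the Ablowitz--Ladik bracket and in the Gelfand--Dikij bracket (for any choice of the extensions). -/

import Mathlib

open scoped Topology ContDiff ComplexConjugate

/- Matrices carry the entrywise sup norm; as the space is finite-dimensional, derivatives and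
smoothness do not depend on this choice. -/
attribute [local instance] Matrix.normedAddCommGroup Matrix.normedSpace

namespace CMV

noncomputable section

/-! ### CMV matrices -/

/-- `ρ = √(1 - |α|²)`. -/
def rho (z : ℂ) : ℝ := Real.sqrt (1 - ‖z‖ ^ 2)

/-- The block-diagonal matrix whose blocks are the `Ξ_k` with `k ≡ p (mod 2)`, for `p = 0, 1`.
With rows and columns numbered from `0`, the `2 × 2` block
`Ξ_k = [[conj α_k, ρ_k], [ρ_k, -α_k]]` occupies the indices `k, k + 1`, the `1 × 1` block
`Ξ_{n-1} = [conj α_{n-1}]` the last index, and `Ξ_{-1} = [1]` the index `0` (when `p = 1`). -/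
def factor {n : ℕ} (p : ℕ) (α : Fin n → ℂ) : Matrix (Fin n) (Fin n) ℂ :=
  Matrix.of fun i j =>
    if i = j then
      if i.val % 2 = p then conj (α i)
      else if i.val = 0 then 1
      else -α ⟨i.val - 1, by omega⟩
    else if i.val + 1 = j.val ∧ i.val % 2 = p then (rho (α i) : ℂ)
    else if j.val + 1 = i.val ∧ j.val % 2 = p then (rho (α j) : ℂ)
    else 0

/-- The CMV matrix `𝓒 = 𝓛 𝓜`, with `𝓛 = diag(Ξ₀, Ξ₂, …)` and `𝓜 = diag(Ξ₋₁, Ξ₁, …)`. -/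
def cmv {n : ℕ} (α : Fin n → ℂ) : Matrix (Fin n) (Fin n) ℂ :=
  factor 0 α * factor 1 α

/-- The `n × n` CMV matrix, `n = m + 1`, with Verblunsky coefficients `α₀, …, α_{n-2}` and
last coefficient `α_{n-1} = a`. -/
def cmvAt {m : ℕ} (a : ℂ) (α : Fin m → ℂ) : Matrix (Fin (m + 1)) (Fin (m + 1)) ℂ :=
  cmv (Fin.snoc (α := fun _ => ℂ) α a)

/-- The manifold of CMV matrices with `α₀, …, α_{n-2}` in the open unit disk and fixed
`α_{n-1} = a`, that is, with fixed determinant `(-1)^{n-1} conj a`. -/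
def leaf (m : ℕ) (a : ℂ) : Set (Matrix (Fin (m + 1)) (Fin (m + 1)) ℂ) :=
  {B | ∃ α : Fin m → ℂ, (∀ k, ‖α k‖ < 1) ∧ B = cmvAt a α}

/-! ### Eigenvalues and spectral measure -/

/-- The mass at `z` of the spectral measure of `B` and `e₁`: the squared norm of the orthogonal
projection of `e₁` to the eigenspace of `B` at `z` (for a unitary matrix `B`). -/
def spectralMass {m : ℕ} (B : Matrix (Fin (m + 1)) (Fin (m + 1)) ℂ) (z : ℂ) : ℝ :=
  ‖(Module.End.eigenspace (Matrix.toEuclideanLin B) z).starProjection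
    (EuclideanSpace.single (0 : Fin (m + 1)) (1 : ℂ))‖ ^ 2

/-- `θ` is a continuous enumeration, over the set `S` of matrices, of the eigenvalues
`e^{iθ_1}, …, e^{iθ_n}`, which are pairwise distinct. -/
structure IsLabelling {n : ℕ} (S : Set (Matrix (Fin n) (Fin n) ℂ))
    (θ : Matrix (Fin n) (Fin n) ℂ → Fin n → ℝ) : Prop where
  continuousOn : ContinuousOn θ S
  range_eq : ∀ B ∈ S, Set.range (fun j => Complex.exp (θ B j * Complex.I)) = spectrum ℂ B
  injective : ∀ B ∈ S, Function.Injective fun j => Complex.exp (θ B j * Complex.I)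

/-- `μ_j`, the mass of the eigenvalue `e^{iθ_j}`. -/
def mass {m : ℕ} (θ : Matrix (Fin (m + 1)) (Fin (m + 1)) ℂ → Fin (m + 1) → ℝ)
    (j : Fin (m + 1)) (B : Matrix (Fin (m + 1)) (Fin (m + 1)) ℂ) : ℝ :=
  spectralMass B (Complex.exp (θ B j * Complex.I))

/-- `log (μ_j / μ_k)`. -/
def logRatio {m : ℕ} (θ : Matrix (Fin (m + 1)) (Fin (m + 1)) ℂ → Fin (m + 1) → ℝ)
    (j k : Fin (m + 1)) (B : Matrix (Fin (m + 1)) (Fin (m + 1)) ℂ) : ℝ :=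
  Real.log (mass θ j B / mass θ k B)

/-! ### The Ablowitz–Ladik bracket -/

/-- `{f, g} = ∑_j ρ_j² (∂f/∂u_j ∂g/∂v_j - ∂f/∂v_j ∂g/∂u_j)`, where `α_j = u_j + i v_j`. -/
def alBracket {m : ℕ} (f g : (Fin m → ℂ) → ℝ) (α : Fin m → ℂ) : ℝ :=
  ∑ j, rho (α j) ^ 2 *
    (fderiv ℝ f α (Pi.single j 1) * fderiv ℝ g α (Pi.single j Complex.I)
      - fderiv ℝ f α (Pi.single j Complex.I) * fderiv ℝ g α (Pi.single j 1))

/-! ### The Gelfand–Dikij bracket -/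

/-- The projection to the anti-Hermitian matrices along the lower triangular matrices with real
diagonal. -/
def piA {n : ℕ} (X : Matrix (Fin n) (Fin n) ℂ) : Matrix (Fin n) (Fin n) ℂ :=
  Matrix.of fun i j =>
    if i < j then X i j
    else if i = j then ((X i i).im : ℂ) * Complex.I
    else -conj (X j i)

/-- The projection to the lower triangular matrices with real diagonal along the anti-Hermitian
matrices. -/
def piL {n : ℕ} (X : Matrix (Fin n) (Fin n) ℂ) : Matrix (Fin n) (Fin n) ℂ :=
  X - piA X

theorem piA_antiHermitian {n : ℕ} (X : Matrix (Fin n) (Fin n) ℂ) :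
    (piA X).conjTranspose = -piA X := by
  ext i j
  simp only [piA, Matrix.conjTranspose_apply, Matrix.of_apply, Matrix.neg_apply]
  rcases lt_trichotomy i j with h | h | h
  · simp [h, h.not_gt, h.ne']
  · subst h; simp
  · simp [h, h.not_gt, h.ne']

theorem piL_lower {n : ℕ} (X : Matrix (Fin n) (Fin n) ℂ) :
    (∀ i j, i < j → piL X i j = 0) ∧ ∀ i, (piL X i i).im = 0 := by
  refine ⟨fun i j h => ?_, fun i => ?_⟩ <;> simp [piL, piA, *]

/-- `R = π_𝔩 - π_𝔞`. -/
def R {n : ℕ} (X : Matrix (Fin n) (Fin n) ℂ) : Matrix (Fin n) (Fin n) ℂ :=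
  piL X - piA X

/-- The pairing `⟨X, Y⟩ = Im tr (X Y)`. -/
def pairing {n : ℕ} (X Y : Matrix (Fin n) (Fin n) ℂ) : ℝ :=
  (X * Y).trace.im

/-- The gradient of `φ` at `B` with respect to `pairing`:
`[∇φ]_{kl} = ∂φ/∂v_{lk} + i ∂φ/∂u_{lk}`, where `b_{kl} = u_{kl} + i v_{kl}` are the entries
of `B`. -/
def grad {n : ℕ} (φ : Matrix (Fin n) (Fin n) ℂ → ℝ) (B : Matrix (Fin n) (Fin n) ℂ) :
    Matrix (Fin n) (Fin n) ℂ :=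
  Matrix.of fun k l =>
    (fderiv ℝ φ B (Matrix.single l k Complex.I) : ℂ)
      + (fderiv ℝ φ B (Matrix.single l k 1) : ℂ) * Complex.I

/-- With `X = ∇φ` and `Y = ∇ψ` at `B`, `{φ, ψ} = ½⟨R(XB), YB⟩ - ½⟨R(BX), BY⟩`. -/
def gdBracket {n : ℕ} (φ ψ : Matrix (Fin n) (Fin n) ℂ → ℝ)
    (B : Matrix (Fin n) (Fin n) ℂ) : ℝ :=
  1 / 2 * pairing (R (grad φ B * B)) (grad ψ B * B)
    - 1 / 2 * pairing (R (B * grad φ B)) (B * grad ψ B)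

/-- `φ` agrees with `F` at all points of `S` near `B`: locally, `φ` extends the function `F`
on `S` to the space of all matrices. -/
def ExtendsNear {n : ℕ} (S : Set (Matrix (Fin n) (Fin n) ℂ))
    (F φ : Matrix (Fin n) (Fin n) ℂ → ℝ) (B : Matrix (Fin n) (Fin n) ℂ) : Prop :=
  ∀ᶠ X in 𝓝[S] B, φ X = F X

end

end CMV

namespace CMV

noncomputable section

/-! ### The complexified Ablowitz–Ladik form and Schur functions -/

/-! The Ablowitz–Ladik bracket is computed on generating functions. Let f(z) be the Schur function
with parameters α₀, …, α_{n-2}, α_{n-1}. Undoing one step of the Schur algorithm adjoins one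
parameter, which Poisson commutes with the Schur function of the later ones. Induction from the
constant α_{n-1} therefore gives {f(z), f(w)} = -2i (f(z) - f(w))(z f(z) - w f(w))/(z - w) in the
unit disk (`alForm_schurIter`).

An explicit solution of (𝓒 - z) y = (1 - z f(z)) e₁ with first entry f(z) shows that the Cauchy
transform G(z) = ∑ μ_j/(ζ_j - z) of the spectral measure equals f/(1 - z f) (`schurFrom_eq_cauchy`),
and the bracket passes to G by the chain rule. Comparing coefficients at the poles z = ζ_j and w =
ζ_k yields {μ_j, μ_k} = 2i μ_j μ_k ((ζ_j + ζ_k)/(ζ_j - ζ_k) + κ_j - κ_k) (`form_dmu_dmu`,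
`alForm_mass`). The terms κ cancel in the bracket of two log-ratios with a common denominator, and
i(ζ_j + ζ_k)/(ζ_j - ζ_k) = cot((θ_j - θ_k)/2) leaves the three cotangents.

For the Gelfand–Dikij bracket the Hamiltonian vector field obeys a Leibniz rule for products
(`hamVec_mul`), so it suffices to treat 𝓛 and 𝓜. There it equals the Ablowitz–Ladik field by a
computation in 2 × 2 blocks (`hamVec_factor`). The field at 𝓒 is thus tangent to M, so the bracket
depends only on restrictions to M and is the Ablowitz–Ladik one (`gdBracket_eq_alBracket`).

Smooth extensions come from the implicit function theorem for simple eigenvalues and an adjugate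
formula for the masses; positivity of the masses comes from cyclicity of e₁. -/

/-- The Ablowitz–Ladik Poisson tensor at `α`, extended to complex-valued differentials. -/
def alForm {m : ℕ} (α : Fin m → ℂ) :
    ((Fin m → ℂ) →L[ℝ] ℂ) →ₗ[ℂ] ((Fin m → ℂ) →L[ℝ] ℂ) →ₗ[ℂ] ℂ :=
  LinearMap.mk₂ ℂ (fun V W => ∑ j, (rho (α j) : ℂ) ^ 2 *
      (V (Pi.single j 1) * W (Pi.single j Complex.I)
        - V (Pi.single j Complex.I) * W (Pi.single j 1)))
    (fun V V' W => by
      rw [← Finset.sum_add_distrib]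
      exact Finset.sum_congr rfl fun j _ => by simp only [add_apply]; ring)
    (fun c V W => by
      rw [smul_eq_mul, Finset.mul_sum]
      exact Finset.sum_congr rfl fun j _ => by
        simp only [smul_apply, smul_eq_mul]; ring)
    (fun V W W' => by
      rw [← Finset.sum_add_distrib]
      exact Finset.sum_congr rfl fun j _ => by simp only [add_apply]; ring)
    (fun c V W => by
      rw [smul_eq_mul, Finset.mul_sum]
      exact Finset.sum_congr rfl fun j _ => by
        simp only [smul_apply, smul_eq_mul]; ring)

theorem alForm_apply {m : ℕ} (α : Fin m → ℂ) (V W : (Fin m → ℂ) →L[ℝ] ℂ) :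
    alForm α V W = ∑ j, (rho (α j) : ℂ) ^ 2 *
      (V (Pi.single j 1) * W (Pi.single j Complex.I)
        - V (Pi.single j Complex.I) * W (Pi.single j 1)) := rfl

theorem alForm_swap {m : ℕ} (α : Fin m → ℂ) (V W : (Fin m → ℂ) →L[ℝ] ℂ) :
    alForm α W V = -alForm α V W := by
  rw [alForm_apply, alForm_apply, ← Finset.sum_neg_distrib]
  exact Finset.sum_congr rfl fun j _ => by ring

theorem alForm_self {m : ℕ} (α : Fin m → ℂ) (V : (Fin m → ℂ) →L[ℝ] ℂ) :
    alForm α V V = 0 := by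
  rw [alForm_apply]
  exact Finset.sum_eq_zero fun j _ => by ring

/-- The differential of `α ↦ α_k`. -/
def dcoord {m : ℕ} (k : Fin m) : (Fin m → ℂ) →L[ℝ] ℂ := ContinuousLinearMap.proj k

/-- The differential of `α ↦ conj α_k`. -/
def dcoordConj {m : ℕ} (k : Fin m) : (Fin m → ℂ) →L[ℝ] ℂ :=
  (Complex.conjCLE : ℂ →L[ℝ] ℂ).comp (dcoord k)

theorem dcoord_single {m : ℕ} (k j : Fin m) (v : ℂ) :
    dcoord k (Pi.single j v) = if k = j then v else 0 := by
  simp [dcoord, Pi.single_apply]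

theorem dcoordConj_single {m : ℕ} (k j : Fin m) (v : ℂ) :
    dcoordConj k (Pi.single j v) = if k = j then conj v else 0 := by
  rw [dcoordConj, ContinuousLinearMap.comp_apply, dcoord_single]
  split_ifs <;> simp

theorem alForm_dcoord_dcoordConj {m : ℕ} (α : Fin m → ℂ) (k : Fin m) :
    alForm α (dcoord k) (dcoordConj k) = -2 * Complex.I * (rho (α k) : ℂ) ^ 2 := by
  rw [alForm_apply, Finset.sum_eq_single k]
  · simp only [dcoord_single, dcoordConj_single, if_true, Complex.conj_I, map_one]; ring
  · intro j _ hj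
    simp only [dcoord_single, dcoordConj_single, if_neg hj.symm]; ring
  · simp

theorem alForm_eq_zero {m : ℕ} (α : Fin m → ℂ) {V W : (Fin m → ℂ) →L[ℝ] ℂ}
    (h : ∀ j, (∀ v, V (Pi.single j v) = 0) ∨ ∀ v, W (Pi.single j v) = 0) :
    alForm α V W = 0 := by
  rw [alForm_apply]
  refine Finset.sum_eq_zero fun j _ => ?_
  rcases h j with h | h <;> simp [h]

theorem rho_sq {z : ℂ} (hz : ‖z‖ ≤ 1) : (rho z : ℂ) ^ 2 = 1 - z * conj z := by
  have h : rho z ^ 2 = 1 - ‖z‖ ^ 2 :=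
    Real.sq_sqrt (by nlinarith [norm_nonneg z])
  rw [← Complex.ofReal_pow, h, Complex.mul_conj']
  push_cast
  rfl

theorem rho_pos {z : ℂ} (hz : ‖z‖ < 1) : 0 < rho z :=
  Real.sqrt_pos.2 (by nlinarith [norm_nonneg z])

/-- One step of the Schur algorithm. -/
def schurStep (γ z g : ℂ) : ℂ := (γ + z * g) / (1 + conj γ * z * g)

theorem schurStep_den_ne {γ z g : ℂ} (hγ : ‖γ‖ < 1) (hz : ‖z‖ < 1) (hg : ‖g‖ ≤ 1) :
    1 + conj γ * z * g ≠ 0 := by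
  intro h
  have h1 : conj γ * z * g = -1 := by linear_combination h
  have h2 : ‖γ‖ * ‖z‖ * ‖g‖ = 1 := by
    have := congrArg norm h1
    simpa using this
  have h3 : ‖γ‖ * ‖z‖ < 1 := by nlinarith [norm_nonneg γ, norm_nonneg z]
  nlinarith [mul_nonneg (norm_nonneg γ) (norm_nonneg z), norm_nonneg g]

theorem norm_schurStep_le {γ z g : ℂ} (hγ : ‖γ‖ < 1) (hz : ‖z‖ < 1) (hg : ‖g‖ ≤ 1) :
    ‖schurStep γ z g‖ ≤ 1 := by
  have hd := schurStep_den_ne hγ hz hg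
  rw [schurStep, norm_div, div_le_one (norm_pos_iff.2 hd)]
  refine le_of_sq_le_sq ?_ (norm_nonneg _)
  have hh : ‖z * g‖ ≤ 1 := by
    rw [norm_mul]; nlinarith [norm_nonneg z, norm_nonneg g]
  -- With h = z g this identity shows that the Möbius map h ↦ (γ + h)/(1 + γ̄ h) preserves the
  -- closed disk.
  have key : ‖1 + conj γ * z * g‖ ^ 2 - ‖γ + z * g‖ ^ 2
      = (1 - ‖γ‖ ^ 2) * (1 - ‖z * g‖ ^ 2) := by
    have e : ∀ w : ℂ, ‖w‖ ^ 2 = w.re ^ 2 + w.im ^ 2 := fun w => by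
      rw [← Complex.normSq_eq_norm_sq, Complex.normSq_apply]; ring
    rw [mul_assoc]
    generalize z * g = h
    simp only [e, Complex.add_re, Complex.add_im, Complex.mul_re, Complex.mul_im, Complex.conj_re,
      Complex.conj_im, Complex.one_re, Complex.one_im]
    ring
  have : 0 ≤ (1 - ‖γ‖ ^ 2) * (1 - ‖z * g‖ ^ 2) :=
    mul_nonneg (by nlinarith [norm_nonneg γ]) (by nlinarith [norm_nonneg (z * g)])
  linarith

/-- The Schur function with Schur parameters `β_{m-l}, …, β_{m-1}, a`, evaluated at `z`. -/
def schurIter {m : ℕ} (a z : ℂ) (β : Fin m → ℂ) : ℕ → ℂ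
  | 0 => a
  | l + 1 => if h : l < m then schurStep (β ⟨m - 1 - l, by omega⟩) z (schurIter a z β l) else 0

theorem schurIter_succ {m : ℕ} (a z : ℂ) (β : Fin m → ℂ) {l : ℕ} (h : l < m) :
    schurIter a z β (l + 1)
      = schurStep (β ⟨m - 1 - l, by omega⟩) z (schurIter a z β l) := by
  rw [schurIter, dif_pos h]

theorem norm_schurIter_le {m : ℕ} {a z : ℂ} {β : Fin m → ℂ} (ha : ‖a‖ = 1) (hz : ‖z‖ < 1)
    (hβ : ∀ k, ‖β k‖ < 1) : ∀ l, ‖schurIter a z β l‖ ≤ 1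
  | 0 => ha.le
  | l + 1 => by
    by_cases h : l < m
    · rw [schurIter_succ a z β h]
      exact norm_schurStep_le (hβ _) hz (norm_schurIter_le ha hz hβ l)
    · rw [schurIter, dif_neg h]; simp

/-- The functions are only real differentiable, but their differentials are combined with complex
coefficients, as needed to expand a ℂ-bilinear form. -/
theorem hasFDerivAt_complex_div {E : Type*} [NormedAddCommGroup E] [NormedSpace ℝ E] {x : E}
    {f g : E → ℂ} {D D' : E →L[ℝ] ℂ} (hf : HasFDerivAt f D x) (hg : HasFDerivAt g D' x)
    (h0 : g x ≠ 0) :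
    HasFDerivAt (fun y => f y / g y) ((1 / g x) • D - (f x / g x ^ 2) • D') x := by
  have hi : HasFDerivAt (fun y => (g y)⁻¹) _ x :=
    ((hasDerivAt_inv h0).hasFDerivAt.restrictScalars ℝ).comp x hg
  convert! hf.mul hi using 1
  ext v
  simp
  field_simp
  ring

theorem hasFDerivAt_schurStep {m : ℕ} {α : Fin m → ℂ} (k : Fin m) (z : ℂ)
    {g : (Fin m → ℂ) → ℂ} {D : (Fin m → ℂ) →L[ℝ] ℂ} (hα : ‖α k‖ < 1) (hg : HasFDerivAt g D α)
    (hd : 1 + conj (α k) * z * g α ≠ 0) :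
    HasFDerivAt (fun β => schurStep (β k) z (g β))
      ((1 / (1 + conj (α k) * z * g α)) • dcoord k
        + (-(z * g α * (α k + z * g α)) / (1 + conj (α k) * z * g α) ^ 2) • dcoordConj k
        + (z * (rho (α k) : ℂ) ^ 2 / (1 + conj (α k) * z * g α) ^ 2) • D) α := by
  have h1 : HasFDerivAt (fun β : Fin m → ℂ => β k) (dcoord k) α := (dcoord k).hasFDerivAt
  have h2 : HasFDerivAt (fun β : Fin m → ℂ => conj (β k)) (dcoordConj k) α :=
    (dcoordConj k).hasFDerivAt
  have h : HasFDerivAt (fun β => schurStep (β k) z (g β)) _ α :=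
    hasFDerivAt_complex_div (h1.add (hg.const_mul z))
      (((h2.mul_const z).mul hg).const_add 1) hd
  refine h.congr_fderiv ?_
  ext v
  rw [rho_sq hα.le]
  simp
  field_simp
  ring

/-- The bracket formula is invariant under a Schur step: the first term comes from {α_k, ᾱ_k} =
-2iρ_k², the second from the bracket `B` of the inner functions, and there are no cross terms. With
γ̄ replaced by an independent γ' the claim is an identity of rational functions. -/
theorem alForm_schurStep_identity {γ γ' z w g h r B : ℂ} (hr : r = 1 - γ * γ') (hzw : z ≠ w)
    (hd : 1 + γ' * z * g ≠ 0) (he : 1 + γ' * w * h ≠ 0)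
    (hB : B = -2 * Complex.I * ((g - h) * (z * g - w * h) / (z - w))) :
    -2 * Complex.I * r * (1 / (1 + γ' * z * g) * (-(w * h * (γ + w * h)) / (1 + γ' * w * h) ^ 2)
        - -(z * g * (γ + z * g)) / (1 + γ' * z * g) ^ 2 * (1 / (1 + γ' * w * h)))
      + z * r / (1 + γ' * z * g) ^ 2 * (w * r / (1 + γ' * w * h) ^ 2) * B
      = -2 * Complex.I * (((γ + z * g) / (1 + γ' * z * g) - (γ + w * h) / (1 + γ' * w * h))
        * (z * ((γ + z * g) / (1 + γ' * z * g)) - w * ((γ + w * h) / (1 + γ' * w * h)))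
          / (z - w)) := by
  have : z - w ≠ 0 := sub_ne_zero.2 hzw
  subst hr hB
  field_simp
  ring

/-- The induction also carries the fact that the iterate does not depend on the coordinates not yet
used; this is what kills the cross terms at the next step. -/
theorem alForm_schurIter {m : ℕ} {a : ℂ} {α : Fin m → ℂ} (ha : ‖a‖ = 1)
    (hα : ∀ k, ‖α k‖ < 1) {l : ℕ} (hl : l ≤ m) :
    (∀ z, ‖z‖ < 1 → DifferentiableAt ℝ (fun β => schurIter a z β l) α ∧
      ∀ j : Fin m, j.val + l < m → ∀ v,
        fderiv ℝ (fun β => schurIter a z β l) α (Pi.single j v) = 0) ∧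
    ∀ z w, ‖z‖ < 1 → ‖w‖ < 1 → z ≠ w →
      alForm α (fderiv ℝ (fun β => schurIter a z β l) α)
          (fderiv ℝ (fun β => schurIter a w β l) α)
        = -2 * Complex.I * ((schurIter a z α l - schurIter a w α l)
          * (z * schurIter a z α l - w * schurIter a w α l) / (z - w)) := by
  induction l with
  | zero => simp [schurIter]
  | succ l ih =>
    have hlm : l < m := hl
    obtain ⟨ih1, ih2⟩ := ih hlm.le
    set k : Fin m := ⟨m - 1 - l, by omega⟩ with hk
    have hden : ∀ z, ‖z‖ < 1 → 1 + conj (α k) * z * schurIter a z α l ≠ 0 := fun z hz =>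
      schurStep_den_ne (hα k) hz (norm_schurIter_le ha hz hα l)
    have hfd : ∀ z, ‖z‖ < 1 → _ := fun z hz =>
      hasFDerivAt_schurStep k z (hα k) (ih1 z hz).1.hasFDerivAt (hden z hz)
    simp only [schurIter_succ a _ _ hlm, ← hk]
    have hoff : ∀ z, ‖z‖ < 1 → ∀ v,
        fderiv ℝ (fun β => schurIter a z β l) α (Pi.single k v) = 0 := fun z hz v =>
      (ih1 z hz).2 k (by simp only [hk]; omega) v
    refine ⟨fun z hz => ⟨(hfd z hz).differentiableAt, fun j hj v => ?_⟩, fun z w hz hw hzw => ?_⟩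
    · have hjk : k ≠ j := fun h => by rw [← h, hk] at hj; simp only at hj; omega
      rw [(hfd z hz).fderiv]
      simp [dcoord_single, dcoordConj_single, hjk, (ih1 z hz).2 j (by omega) v]
    · rw [(hfd z hz).fderiv, (hfd w hw).fderiv]
      set Dz := fderiv ℝ (fun β => schurIter a z β l) α
      set Dw := fderiv ℝ (fun β => schurIter a w β l) α
      have hE : ∀ D : (Fin m → ℂ) →L[ℝ] ℂ, (∀ v, D (Pi.single k v) = 0) →
          alForm α (dcoord k) D = 0 ∧ alForm α (dcoordConj k) D = 0 := fun D hD => by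
        refine ⟨alForm_eq_zero α fun j => ?_, alForm_eq_zero α fun j => ?_⟩ <;>
        · rcases eq_or_ne k j with rfl | h
          · exact Or.inr hD
          · exact Or.inl fun v => by simp [dcoord_single, dcoordConj_single, h]
      have e1 := hE Dz (hoff z hz)
      have e2 := hE Dw (hoff w hw)
      have e3 := ih2 z w hz hw hzw
      have e4 := alForm_dcoord_dcoordConj α k
      simp only [map_add, map_smul, LinearMap.add_apply, LinearMap.smul_apply, smul_eq_mul,
        alForm_self, e1.1, e1.2, e2.1, e2.2, alForm_swap α (dcoord k) (dcoordConj k),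
        alForm_swap α (dcoord k) Dz, alForm_swap α (dcoordConj k) Dz, e4]
      have key := alForm_schurStep_identity (rho_sq (hα k).le) hzw (hden z hz) (hden w hw) e3
      simp only [schurStep]
      rw [← key]
      ring

/-! ### Extraction of the simple-pole coefficients -/

/-- The bracket identities hold only inside the disk, so a boundary pole is approached along a
radius. One direction u ≠ 0 already determines a complex derivative. -/
theorem deriv_eq_of_eq_on_ray {f g : ℂ → ℂ} {f' g' u : ℂ} (hf : HasDerivAt f f' 0)
    (hg : HasDerivAt g g' 0) (hu : u ≠ 0)
    (h : ∀ ε : ℝ, 0 < ε → ε < 1 → f (ε * u) = g (ε * u)) : f' = g' := by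
  have hc : ∀ {p : ℂ → ℂ} {p' : ℂ}, HasDerivAt p p' 0 →
      HasDerivWithinAt (fun ε : ℝ => p (ε * u)) (p' * u) (Set.Ioo 0 1) 0 := by
    intro p p' hp
    have h1 : HasDerivAt (fun ε : ℝ => (ε : ℂ) * u) (1 * u) 0 :=
      (Complex.ofRealCLM.hasDerivAt (x := (0 : ℝ))).mul_const u
    have h2 : HasDerivAt p p' ((fun ε : ℝ => (ε : ℂ) * u) 0) := by simpa using hp
    have h3 := (h2.comp (0 : ℝ) h1).hasDerivWithinAt (s := Set.Ioo (0 : ℝ) 1)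
    rw [one_mul] at h3
    exact h3
  have hcl : (0 : ℝ) ∈ closure (Set.Ioo (0 : ℝ) 1) := by
    rw [closure_Ioo zero_ne_one]; simp
  have h0 : f 0 = g 0 := by
    have hne : (𝓝[Set.Ioo (0 : ℝ) 1] 0).NeBot := mem_closure_iff_nhdsWithin_neBot.1 hcl
    have ha := (hc hf).continuousWithinAt.tendsto
    have hb := (hc hg).continuousWithinAt.tendsto
    have hab : (fun ε : ℝ => f (ε * u)) =ᶠ[𝓝[Set.Ioo (0 : ℝ) 1] 0] fun ε : ℝ => g (ε * u) := by
      filter_upwards [self_mem_nhdsWithin] with ε hε using h ε hε.1 hε.2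
    have := tendsto_nhds_unique (ha.congr' hab) hb
    simpa using this
  have hud : UniqueDiffWithinAt ℝ (Set.Ioo (0 : ℝ) 1) 0 := by
    refine uniqueDiffWithinAt_convex (convex_Ioo 0 1) ?_ hcl
    rw [isOpen_Ioo.interior_eq]
    exact ⟨1 / 2, by norm_num, by norm_num⟩
  have he : f' * u = g' * u :=
    hud.eq_deriv _ ((hc hf)) ((hc hg).congr (fun ε hε => h ε hε.1 hε.2) (by simp [h0]))
  exact mul_right_cancel₀ hu he

section Poles

variable {ι : Type*} [Fintype ι] [DecidableEq ι]

/-- The Cauchy transform `∑ μ_l / (ζ_l - z)` of a finite measure. -/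
def cauchy (μ ζ : ι → ℂ) (z : ℂ) : ℂ := ∑ l, μ l / (ζ l - z)

/-- The part of `cauchy μ ζ (ζ_j - t)` that is regular at `t = 0`. -/
def cauchyReg (μ ζ : ι → ℂ) (j : ι) (t : ℂ) : ℂ :=
  ∑ l ∈ Finset.univ.erase j, μ l / (ζ l - ζ j + t)

/-- The differential of `cauchy μ ζ z` in terms of the differentials of `μ` and `ζ`. -/
def dcauchy {V : Type*} [AddCommGroup V] [Module ℂ V] (μ ζ : ι → ℂ) (dμ dζ : ι → V) (z : ℂ) : V :=
  ∑ l, ((1 / (ζ l - z)) • dμ l - (μ l / (ζ l - z) ^ 2) • dζ l)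

theorem mul_cauchy (μ ζ : ι → ℂ) (j : ι) {t : ℂ} (ht : t ≠ 0) :
    t * cauchy μ ζ (ζ j - t) = μ j + t * cauchyReg μ ζ j t := by
  rw [cauchy, ← Finset.add_sum_erase _ _ (Finset.mem_univ j), mul_add, cauchyReg]
  congr 1
  · rw [sub_sub_cancel]; field_simp
  · congr 1
    exact Finset.sum_congr rfl fun l _ => by rw [sub_add]

theorem differentiableAt_cauchyReg (μ : ι → ℂ) {ζ : ι → ℂ} (hζ : Function.Injective ζ) (j : ι) :
    DifferentiableAt ℂ (cauchyReg μ ζ j) 0 := by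
  refine DifferentiableAt.fun_sum fun l hl => ?_
  have : ζ l - ζ j + 0 ≠ 0 := by
    rw [add_zero]; exact sub_ne_zero.2 (hζ.ne (Finset.ne_of_mem_erase hl))
  exact (differentiableAt_const _).div (by fun_prop) this

/-- Since the pole ζ_j itself moves, the differential has a double pole with coefficient -μ_j dζ_j
besides the simple pole dμ_j. Multiplying by t² makes the latter a first derivative at t = 0. -/
theorem sq_mul_dcauchy {V : Type*} [AddCommGroup V] [Module ℂ V] (Λ : V →ₗ[ℂ] ℂ) (μ ζ : ι → ℂ)
    (dμ dζ : ι → V) (j : ι) {t : ℂ} (ht : t ≠ 0) :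
    t ^ 2 * Λ (dcauchy μ ζ dμ dζ (ζ j - t)) = -(μ j * Λ (dζ j)) + t * Λ (dμ j)
      + t ^ 2 * ∑ l ∈ Finset.univ.erase j,
        (Λ (dμ l) / (ζ l - ζ j + t) - μ l * Λ (dζ l) / (ζ l - ζ j + t) ^ 2) := by
  rw [dcauchy, map_sum, ← Finset.add_sum_erase _ _ (Finset.mem_univ j), mul_add]
  congr 1
  · rw [sub_sub_cancel]
    simp only [map_sub, map_smul, smul_eq_mul]
    field_simp
    ring
  · congr 1
    refine Finset.sum_congr rfl fun l _ => ?_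
    simp only [map_sub, map_smul, smul_eq_mul, sub_add]
    ring

/-- The coefficient of the simple pole of `Λ (dcauchy μ ζ dμ dζ z)` at `z = ζ_j`. -/
theorem apply_eq_of_dcauchy {V : Type*} [AddCommGroup V] [Module ℂ V] (Λ : V →ₗ[ℂ] ℂ)
    {μ ζ : ι → ℂ} (hζ : Function.Injective ζ) {dμ dζ : ι → V} {j : ι} (h0 : ζ j ≠ 0)
    {g : ℂ → ℂ} {g' : ℂ} (hg : HasDerivAt g g' 0)
    (h : ∀ ε : ℝ, 0 < ε → ε < 1 →
      (ε * ζ j) ^ 2 * Λ (dcauchy μ ζ dμ dζ (ζ j - ε * ζ j)) = g (ε * ζ j)) :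
    Λ (dμ j) = g' := by
  set K : ℂ → ℂ := fun t => ∑ l ∈ Finset.univ.erase j,
    (Λ (dμ l) / (ζ l - ζ j + t) - μ l * Λ (dζ l) / (ζ l - ζ j + t) ^ 2) with hK
  have hKd : DifferentiableAt ℂ K 0 := by
    refine DifferentiableAt.fun_sum fun l hl => ?_
    have : ζ l - ζ j + 0 ≠ 0 := by
      rw [add_zero]; exact sub_ne_zero.2 (hζ.ne (Finset.ne_of_mem_erase hl))
    exact ((differentiableAt_const _).div (by fun_prop) this).sub
      ((differentiableAt_const _).div (by fun_prop) (pow_ne_zero 2 this))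
  have hf : HasDerivAt (fun t => -(μ j * Λ (dζ j)) + t * Λ (dμ j) + t ^ 2 * K t) (Λ (dμ j)) 0 := by
    have := (((hasDerivAt_id (0 : ℂ)).mul_const (Λ (dμ j))).const_add (-(μ j * Λ (dζ j)))).add
      (((hasDerivAt_id (0 : ℂ)).pow 2).mul hKd.hasDerivAt)
    refine (this.congr_deriv ?_)
    simp
  -- Here t = ε ζ_j, so ζ_j - t = (1 - ε) ζ_j tends radially to the unit circle.
  refine deriv_eq_of_eq_on_ray hf hg h0 fun ε h1 h2 => ?_
  rw [← h ε h1 h2, sq_mul_dcauchy Λ μ ζ dμ dζ j (mul_ne_zero (by exact_mod_cast h1.ne') h0)]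

/-- `2 ζ_j A_j - μ_j`, where `A_j` is the value of the regular part at `ζ_j`. -/
def cauchyGauge (μ ζ : ι → ℂ) (j : ι) : ℂ := 2 * ζ j * cauchyReg μ ζ j 0 - μ j

theorem hasDerivAt_const_add_mul {H : ℂ → ℂ} (hH : DifferentiableAt ℂ H 0) (c : ℂ) :
    HasDerivAt (fun t => c + t * H t) (H 0) 0 := by
  have := ((hasDerivAt_id (0 : ℂ)).mul hH.hasDerivAt).const_add c
  exact this.congr_deriv (by simp)

theorem norm_sub_mul_lt {u : ℂ} (hu : ‖u‖ = 1) {ε : ℝ} (h0 : 0 < ε) (h1 : ε < 1) :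
    ‖u - ε * u‖ < 1 := by
  have : u - ε * u = ((1 - ε : ℝ) : ℂ) * u := by push_cast; ring
  rw [this, norm_mul, hu, Complex.norm_real, Real.norm_of_nonneg (by linarith)]
  linarith

theorem ne_of_norm_lt {u w : ℂ} (hu : ‖u‖ = 1) (hw : ‖w‖ < 1) : u - w ≠ 0 := fun h => by
  rw [← sub_eq_zero.1 h, hu] at hw; exact lt_irrefl _ hw

variable {V : Type*} [AddCommGroup V] [Module ℂ V] {B : V →ₗ[ℂ] V →ₗ[ℂ] ℂ} {μ ζ : ι → ℂ}
  {dμ dζ : ι → V}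

/-- The first of two pole extractions, in z at ζ_j with w fixed in the disk. -/
theorem form_dmu_dcauchy (hζ : Function.Injective ζ) (h1 : ∀ l, ‖ζ l‖ = 1)
    (hB : ∀ z w, ‖z‖ < 1 → ‖w‖ < 1 →
      B (dcauchy μ ζ dμ dζ z) (dcauchy μ ζ dμ dζ w)
        = -2 * Complex.I * ((z * cauchy μ ζ z - w * cauchy μ ζ w)
          * ((cauchy μ ζ z - cauchy μ ζ w) / (z - w) - cauchy μ ζ z * cauchy μ ζ w)))
    (j : ι) {w : ℂ} (hw : ‖w‖ < 1) :
    B (dμ j) (dcauchy μ ζ dμ dζ w)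
      = -2 * Complex.I * ((-μ j + ζ j * cauchyReg μ ζ j 0 - w * cauchy μ ζ w)
          * (μ j / (ζ j - w) - μ j * cauchy μ ζ w)
        + ζ j * μ j * ((cauchyReg μ ζ j 0 - cauchy μ ζ w) / (ζ j - w) + μ j / (ζ j - w) ^ 2
          - cauchyReg μ ζ j 0 * cauchy μ ζ w)) := by
  set A := cauchyReg μ ζ j 0 with hA
  set G := cauchy μ ζ w
  have h0 : ζ j ≠ 0 := fun h => by simpa [h] using h1 j
  have hjw := ne_of_norm_lt (h1 j) hw
  have hU := hasDerivAt_const_add_mul (differentiableAt_cauchyReg μ hζ j) (μ j)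
  rw [← hA] at hU
  have hid := hasDerivAt_id (0 : ℂ)
  have hz : HasDerivAt (fun t : ℂ => ζ j - t) (-1) 0 := hid.const_sub (ζ j)
  -- The factor t² is split as t · t, one for each factor of the bracket formula; t G(ζ_j - t) = μ_j
  -- + t A(t) is regular at 0.
  have hP := (hz.mul hU).sub (hid.mul_const (w * G))
  have hQ := ((hU.sub (hid.mul_const G)).div (hz.sub_const w) (by simpa using hjw)).sub
    (hU.mul_const G)
  have hg := (hP.mul hQ).const_mul (-2 * Complex.I)
  have key := apply_eq_of_dcauchy (B.flip (dcauchy μ ζ dμ dζ w)) hζ (dμ := dμ) (dζ := dζ)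
    (μ := μ) h0 hg ?_
  · rw [LinearMap.flip_apply] at key
    rw [key]
    simp only [Pi.mul_apply, Pi.sub_apply, Pi.div_apply, id, sub_zero, zero_mul, add_zero]
    field_simp
    ring
  · intro ε he0 he1
    have ht : (ε : ℂ) * ζ j ≠ 0 := mul_ne_zero (by exact_mod_cast he0.ne') h0
    simp only [Pi.mul_apply, Pi.sub_apply, Pi.div_apply, id]
    rw [LinearMap.flip_apply, hB _ _ (norm_sub_mul_lt (h1 j) he0 he1) hw, ← mul_cauchy μ ζ j ht]
    ring

/-- The second extraction, in w at ζ_k. The regular parts survive only in a difference of a function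
of j and the same function of k. -/
theorem form_dmu_dmu (hζ : Function.Injective ζ) (h1 : ∀ l, ‖ζ l‖ = 1)
    (hB : ∀ z w, ‖z‖ < 1 → ‖w‖ < 1 →
      B (dcauchy μ ζ dμ dζ z) (dcauchy μ ζ dμ dζ w)
        = -2 * Complex.I * ((z * cauchy μ ζ z - w * cauchy μ ζ w)
          * ((cauchy μ ζ z - cauchy μ ζ w) / (z - w) - cauchy μ ζ z * cauchy μ ζ w)))
    {j k : ι} (hjk : j ≠ k) :
    B (dμ j) (dμ k) = 2 * Complex.I * μ j * μ k * ((ζ j + ζ k) / (ζ j - ζ k)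
      + cauchyGauge μ ζ j - cauchyGauge μ ζ k) := by
  set A := cauchyReg μ ζ j 0
  set A' := cauchyReg μ ζ k 0 with hA'
  have h0 : ζ k ≠ 0 := fun h => by simpa [h] using h1 k
  have hjk' : ζ j - ζ k ≠ 0 := sub_ne_zero.2 (hζ.ne hjk)
  have hU := hasDerivAt_const_add_mul (differentiableAt_cauchyReg μ hζ k) (μ k)
  rw [← hA'] at hU
  have hid := hasDerivAt_id (0 : ℂ)
  have hw : HasDerivAt (fun t : ℂ => ζ k - t) (-1) 0 := hid.const_sub (ζ k)
  have hd : HasDerivAt (fun t : ℂ => ζ j - (ζ k - t)) (- -1) 0 := hw.const_sub (ζ j)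
  have hd0 : ζ j - (ζ k - 0) ≠ 0 := by simpa using hjk'
  have hP := (hid.mul_const (-μ j + ζ j * A)).sub (hw.mul hU)
  have hQ := ((hid.mul_const (μ j)).div hd hd0).sub (hU.const_mul (μ j))
  have hS := ((((hid.pow 2).mul_const A).sub (hid.mul hU)).div hd hd0).add
    (((hid.pow 2).mul_const (μ j)).div (hd.pow 2) (pow_ne_zero 2 hd0))
  -- Again t² is distributed over the terms, each power of t turning one factor G(w) into μ_k + t
  -- A'(t).
  have hg := ((hP.mul hQ).add ((hS.sub ((hid.mul hU).const_mul A)).const_mul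
    (ζ j * μ j))).const_mul (-2 * Complex.I)
  have key := apply_eq_of_dcauchy (B (dμ j)) hζ (dμ := dμ) (dζ := dζ) (μ := μ) h0 hg ?_
  · rw [key, cauchyGauge, cauchyGauge]
    simp only [Pi.mul_apply, Pi.sub_apply, Pi.div_apply, Pi.pow_apply, id, sub_zero,
      zero_mul, add_zero]
    field_simp
    ring
  · intro ε he0 he1
    have ht : (ε : ℂ) * ζ k ≠ 0 := mul_ne_zero (by exact_mod_cast he0.ne') h0
    have hw1 := norm_sub_mul_lt (h1 k) he0 he1
    simp only [Pi.mul_apply, Pi.sub_apply, Pi.div_apply, Pi.pow_apply, Pi.add_apply, id]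
    rw [form_dmu_dcauchy hζ h1 hB j hw1, ← mul_cauchy μ ζ k ht]
    ring

end Poles

end

end CMV

namespace CMV

noncomputable section

open Matrix

/-! ### The block factors of a CMV matrix -/

theorem rho_conj (z : ℂ) : rho (conj z) = rho z := by simp [rho]

/-- A row of a factor is of one of four kinds: start or end of a 2 × 2 block, the last 1 × 1 block,
or the initial entry 1. These four row formulas replace the definition by cases in all that follows.
-/
theorem factor_mulVec_of_start {n p : ℕ} (A : Fin n → ℂ) (x : Fin n → ℂ) {i : Fin n}
    (hi : i.val % 2 = p) (h : i.val + 1 < n) :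
    (factor p A *ᵥ x) i = conj (A i) * x i + rho (A i) * x ⟨i.val + 1, h⟩ := by
  rw [mulVec, dotProduct, Finset.sum_eq_add i ⟨i.val + 1, h⟩]
  · simp [factor, hi, Fin.ext_iff]
  · simp [Fin.ext_iff]
  · intro c _ hc
    have h1 : i ≠ c := fun e => hc.1 e.symm
    have h2 : ¬ (i.val + 1 = c.val) := fun e => hc.2 (Fin.ext e.symm)
    have h3 : ¬ (c.val + 1 = i.val ∧ c.val % 2 = p) := by omega
    simp [factor, h1, h2, h3]
  · simp
  · simp

theorem factor_mulVec_of_last {n p : ℕ} (A : Fin n → ℂ) (x : Fin n → ℂ) {i : Fin n}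
    (hi : i.val % 2 = p) (h : ¬ i.val + 1 < n) :
    (factor p A *ᵥ x) i = conj (A i) * x i := by
  rw [mulVec, dotProduct, Finset.sum_eq_single i]
  · simp [factor, hi]
  · intro c _ hc
    have h1 : i ≠ c := fun e => hc e.symm
    have h2 : ¬ (i.val + 1 = c.val) := by omega
    have h3 : ¬ (c.val + 1 = i.val ∧ c.val % 2 = p) := by omega
    simp [factor, h1, h2, h3]
  · simp

theorem factor_mulVec_of_zero {n p : ℕ} (A : Fin n → ℂ) (x : Fin n → ℂ) {i : Fin n}
    (hi : i.val % 2 ≠ p) (h : i.val = 0) : (factor p A *ᵥ x) i = x i := by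
  rw [mulVec, dotProduct, Finset.sum_eq_single i]
  · simp only [factor, of_apply, if_true, if_neg hi, if_pos h, one_mul]
  · intro c _ hc
    have h1 : i ≠ c := fun e => hc e.symm
    have h3 : ¬ (c.val + 1 = i.val) := by omega
    simp [factor, h1, hi, h3]
  · simp

theorem factor_mulVec_of_end {n p : ℕ} (_hp : p < 2) (A : Fin n → ℂ) (x : Fin n → ℂ)
    {k : ℕ} (hk : k % 2 = p) (h : k + 1 < n) :
    (factor p A *ᵥ x) ⟨k + 1, h⟩ = rho (A ⟨k, by omega⟩) * x ⟨k, by omega⟩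
      - A ⟨k, by omega⟩ * x ⟨k + 1, h⟩ := by
  have hi : (k + 1) % 2 ≠ p := by omega
  rw [mulVec, dotProduct, Finset.sum_eq_add ⟨k, by omega⟩ ⟨k + 1, h⟩]
  · simp [factor, hi, hk]
    ring
  · simp
  · intro c _ hc
    have h1 : (⟨k + 1, h⟩ : Fin n) ≠ c := fun e => hc.2 e.symm
    have h3 : ¬ (c.val + 1 = k + 1) := fun e => hc.1 (Fin.ext (by simpa using e))
    have h3' : ¬ (c.val = k) := by omega
    simp [factor, h1, hi, h3']
  · simp
  · simp

theorem factor_transpose {n : ℕ} (p : ℕ) (A : Fin n → ℂ) : (factor p A)ᵀ = factor p A := by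
  ext i j
  simp only [transpose_apply, factor, of_apply]
  by_cases h : i = j
  · subst h; simp
  · rw [if_neg h, if_neg (Ne.symm h)]
    split_ifs <;> first | rfl | omega

theorem factor_conjTranspose {n : ℕ} (p : ℕ) (A : Fin n → ℂ) :
    (factor p A)ᴴ = factor p (fun k => conj (A k)) := by
  rw [← factor_transpose p A, conjTranspose, transpose_transpose]
  ext i j
  simp only [map_apply, factor, of_apply, rho_conj]
  split_ifs <;> simp

/-- Each block is unitary because ρ² + |α|² = 1. As the factors are symmetric, the adjoint is the
factor with conjugated parameters. -/
theorem factor_mul_factor_conj {n p : ℕ} (hp : p < 2) {A : Fin n → ℂ} (hA : ∀ k, ‖A k‖ ≤ 1)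
    (hlast : ∀ k : Fin n, ¬ k.val + 1 < n → ‖A k‖ = 1) :
    factor p A * factor p (fun k => conj (A k)) = 1 := by
  refine Matrix.ext_iff_mulVec.2 fun x => ?_
  rw [← mulVec_mulVec, one_mulVec]
  ext i
  by_cases hi : i.val % 2 = p
  · by_cases h : i.val + 1 < n
    · rw [factor_mulVec_of_start A _ hi h, factor_mulVec_of_start _ _ hi h,
        factor_mulVec_of_end hp _ _ hi h]
      simp only [rho_conj, Complex.conj_conj]
      have := rho_sq (hA i)
      linear_combination x i * this
    · rw [factor_mulVec_of_last A _ hi h, factor_mulVec_of_last _ _ hi h]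
      have := Complex.mul_conj' (A i)
      rw [hlast i h] at this
      simp only [Complex.conj_conj]
      push_cast at this
      linear_combination x i * this
  · by_cases h : i.val = 0
    · rw [factor_mulVec_of_zero A _ hi h, factor_mulVec_of_zero _ _ hi h]
    · obtain ⟨k, hk⟩ : ∃ k, i.val = k + 1 := ⟨i.val - 1, by omega⟩
      obtain ⟨i, hin⟩ := i
      obtain rfl : i = k + 1 := hk
      have hkp : k % 2 = p := by simp only at hi; omega
      rw [factor_mulVec_of_end hp A _ hkp hin,
        factor_mulVec_of_start _ _ (i := ⟨k, by omega⟩) hkp hin, factor_mulVec_of_end hp _ _ hkp hin]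
      simp only [rho_conj, Complex.conj_conj]
      have := rho_sq (hA ⟨k, by omega⟩)
      linear_combination x ⟨k + 1, hin⟩ * this

/-- Verblunsky coefficients including the last one. -/
abbrev full {m : ℕ} (a : ℂ) (α : Fin m → ℂ) : Fin (m + 1) → ℂ :=
  Fin.snoc (α := fun _ => ℂ) α a

theorem full_of_lt {m : ℕ} (a : ℂ) (α : Fin m → ℂ) {k : ℕ} (h : k < m) {h' : k < m + 1} :
    full a α ⟨k, h'⟩ = α ⟨k, h⟩ := by
  simp [full, Fin.snoc, h]

theorem full_last {m : ℕ} (a : ℂ) (α : Fin m → ℂ) {h' : m < m + 1} :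
    full a α ⟨m, h'⟩ = a := by
  simp [full, Fin.snoc]

theorem norm_full_le {m : ℕ} {a : ℂ} (ha : ‖a‖ = 1) {α : Fin m → ℂ} (hα : ∀ k, ‖α k‖ < 1)
    (k : Fin (m + 1)) : ‖full a α k‖ ≤ 1 := by
  obtain ⟨k, hk⟩ := k
  by_cases h : k < m
  · rw [full_of_lt a α h]; exact (hα _).le
  · obtain rfl : k = m := by omega
    rw [full_last]; exact ha.le

theorem norm_full_last {m : ℕ} {a : ℂ} (ha : ‖a‖ = 1) (α : Fin m → ℂ)
    (k : Fin (m + 1)) (hk : ¬ k.val + 1 < m + 1) : ‖full a α k‖ = 1 := by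
  obtain ⟨k, hk'⟩ := k
  obtain rfl : k = m := by simp only at hk; omega
  rw [full_last, ha]

theorem factor_full_mul_conj {m p : ℕ} (hp : p < 2) {a : ℂ} (ha : ‖a‖ = 1) {α : Fin m → ℂ}
    (hα : ∀ k, ‖α k‖ < 1) :
    factor p (full a α) * factor p (fun k => conj (full a α k)) = 1 :=
  factor_mul_factor_conj hp (norm_full_le ha hα) (norm_full_last ha α)

theorem cmvAt_mul_conjTranspose {m : ℕ} {a : ℂ} (ha : ‖a‖ = 1) {α : Fin m → ℂ}
    (hα : ∀ k, ‖α k‖ < 1) : cmvAt a α * (cmvAt a α)ᴴ = 1 := by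
  rw [cmvAt, cmv, conjTranspose_mul, factor_conjTranspose, factor_conjTranspose, Matrix.mul_assoc,
    ← Matrix.mul_assoc (factor 1 _) (factor 1 _), factor_full_mul_conj one_lt_two ha hα,
    Matrix.one_mul, factor_full_mul_conj two_pos ha hα]

/-! ### The resolvent of a CMV matrix and the Schur algorithm -/

/-- The Schur function with parameters `α_k, …, α_{m-1}, a`. -/
def schurFrom {m : ℕ} (a z : ℂ) (α : Fin m → ℂ) (k : ℕ) : ℂ := schurIter a z α (m - k)

theorem schurFrom_of_lt {m : ℕ} (a z : ℂ) (α : Fin m → ℂ) {k : ℕ} (h : k < m) :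
    schurFrom a z α k = schurStep (α ⟨k, h⟩) z (schurFrom a z α (k + 1)) := by
  have h1 : m - k = m - (k + 1) + 1 := by omega
  have h2 : m - 1 - (m - (k + 1)) = k := by omega
  rw [schurFrom, h1, schurIter_succ a z α (by omega), schurFrom]
  simp only [h2]

theorem schurFrom_last {m : ℕ} (a z : ℂ) (α : Fin m → ℂ) : schurFrom a z α m = a := by
  simp [schurFrom, schurIter]

/-- Denominators of the continued fraction solving `(𝓛 - z 𝓜*) x = c e₁`. -/
def schurDen {m : ℕ} (a z : ℂ) (α : Fin m → ℂ) : ℕ → ℂ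
  | 0 => 1
  | k + 1 => if h : k < m then
      rho (α ⟨k, h⟩) / (1 + conj (α ⟨k, h⟩) * z * schurFrom a z α (k + 1))
        * (if k % 2 = 0 then 1 else z) * schurDen a z α k
    else 0

/-- The solution of `(𝓛 - z 𝓜*) x = c e₁`. -/
def schurVec {m : ℕ} (a z : ℂ) (α : Fin m → ℂ) (k : Fin (m + 1)) : ℂ :=
  if k.val % 2 = 0 then schurFrom a z α k * schurDen a z α k else schurDen a z α k

/-- In a block the Schur step reads Ξ_k (f_k, d) = (1, z f_{k+1} d) with d = ρ_k/(1 + ᾱ_k z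
f_{k+1}). Hence the vectors 𝓛x here and z𝓜*x in the next lemma agree except in row 0, where they are
1 and z f₀. -/
theorem factor_zero_mulVec_schurVec {m : ℕ} {a z : ℂ} (ha : ‖a‖ = 1) (hz : ‖z‖ < 1)
    {α : Fin m → ℂ} (hα : ∀ k, ‖α k‖ < 1) (k : Fin (m + 1)) :
    (factor 0 (full a α) *ᵥ schurVec a z α) k =
      if k.val % 2 = 0 then schurDen a z α k
      else z * (schurFrom a z α k * schurDen a z α k) := by
  have hden : ∀ j : Fin m, 1 + conj (α j) * z * schurFrom a z α (j + 1) ≠ 0 := fun j =>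
    schurStep_den_ne (hα j) hz (norm_schurIter_le ha hz hα _)
  obtain ⟨k, hk⟩ := k
  by_cases h0 : k % 2 = 0
  · by_cases h : k < m
    · have hd := hden ⟨k, h⟩
      simp only at hd
      rw [factor_mulVec_of_start _ _ h0 (by simpa using h), full_of_lt a α h]
      have h1 : ¬ (k + 1) % 2 = 0 := by omega
      simp only [schurVec, h0, h1, if_true, if_false, schurDen, h, dif_pos,
        schurFrom_of_lt a z α h, schurStep]
      have := rho_sq (hα ⟨k, h⟩).le
      field_simp
      linear_combination schurDen a z α k * this
    · obtain rfl : k = m := by omega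
      rw [factor_mulVec_of_last _ _ h0 (by simp), full_last]
      have := Complex.mul_conj' a
      rw [ha] at this
      push_cast at this
      simp only [schurVec, h0, if_true, schurFrom_last]
      linear_combination schurDen a z α k * this
  · obtain ⟨k, rfl⟩ : ∃ j, k = j + 1 := ⟨k - 1, by omega⟩
    have hk0 : k % 2 = 0 := by omega
    have h : k < m := by omega
    have hd := hden ⟨k, h⟩
    simp only at hd
    rw [factor_mulVec_of_end two_pos _ _ hk0 hk, full_of_lt a α h]
    simp only [schurVec, h0, hk0, if_true, if_false, schurDen, h, dif_pos,
      schurFrom_of_lt a z α h, schurStep]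
    field_simp
    ring

theorem factor_one_conj_mulVec_schurVec {m : ℕ} {a z : ℂ} (ha : ‖a‖ = 1) (hz : ‖z‖ < 1)
    {α : Fin m → ℂ} (hα : ∀ k, ‖α k‖ < 1) (k : Fin (m + 1)) :
    z * (factor 1 (fun k => conj (full a α k)) *ᵥ schurVec a z α) k =
      if k.val = 0 then z * schurFrom a z α 0 else
      if k.val % 2 = 0 then schurDen a z α k
      else z * (schurFrom a z α k * schurDen a z α k) := by
  have hden : ∀ j : Fin m, 1 + conj (α j) * z * schurFrom a z α (j + 1) ≠ 0 := fun j =>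
    schurStep_den_ne (hα j) hz (norm_schurIter_le ha hz hα _)
  obtain ⟨k, hk⟩ := k
  by_cases h0 : k % 2 = 0
  · rcases k with _ | k
    · rw [factor_mulVec_of_zero _ _ (by simp) rfl]
      simp [schurVec, schurDen]
    · have hk0 : k % 2 = 1 := by omega
      have h : k < m := by omega
      have hd := hden ⟨k, h⟩
      simp only at hd
      rw [factor_mulVec_of_end one_lt_two _ _ hk0 hk, full_of_lt a α h, rho_conj]
      simp only [schurVec, h0, hk0, if_true, schurDen, h, dif_pos, Nat.add_one_ne_zero,
        if_false, one_ne_zero]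
      have hi := inv_mul_cancel₀ hd
      simp only [div_eq_mul_inv]
      linear_combination (-z * rho (α ⟨k, h⟩) * schurDen a z α k) * hi
  · have hk1 : k % 2 = 1 := by omega
    have hkz : k ≠ 0 := by omega
    by_cases h : k < m
    · have hd := hden ⟨k, h⟩
      simp only at hd
      rw [factor_mulVec_of_start _ _ hk1 (by simpa using h), full_of_lt a α h, rho_conj,
        Complex.conj_conj]
      have h1 : (k + 1) % 2 = 0 := by omega
      simp only [schurVec, h0, h1, if_true, if_false, schurDen, h, dif_pos,
        schurFrom_of_lt a z α h, schurStep, hkz]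
      have := rho_sq (hα ⟨k, h⟩).le
      have hi := inv_mul_cancel₀ hd
      simp only [div_eq_mul_inv]
      linear_combination (z * schurDen a z α k * schurFrom a z α (k + 1) * z
        * (1 + conj (α ⟨k, h⟩) * z * schurFrom a z α (k + 1))⁻¹) * this
        - (z * schurDen a z α k * α ⟨k, h⟩) * hi
    · obtain rfl : k = m := by omega
      rw [factor_mulVec_of_last _ _ hk1 (by simp), full_last]
      simp [schurVec, h0, hkz, schurFrom_last]

/-- `(𝓒 - z) y = (1 - z f(z)) e₁` has a solution with first entry `f(z)`. -/
theorem exists_cmvAt_mulVec_sub {m : ℕ} {a z : ℂ} (ha : ‖a‖ = 1) (hz : ‖z‖ < 1)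
    {α : Fin m → ℂ} (hα : ∀ k, ‖α k‖ < 1) :
    ∃ y : Fin (m + 1) → ℂ, y 0 = schurFrom a z α 0 ∧
      cmvAt a α *ᵥ y - z • y = Pi.single 0 (1 - z * schurFrom a z α 0) := by
  -- With y = 𝓜*x and 𝓜𝓜* = 1, the equation for y becomes the one for (𝓛 - z𝓜*) x.
  refine ⟨factor 1 (fun k => conj (full a α k)) *ᵥ schurVec a z α, ?_, ?_⟩
  · rw [factor_mulVec_of_zero _ _ (by simp) (by simp)]
    simp [schurVec, schurDen]
  · have e : cmvAt a α *ᵥ (factor 1 (fun k => conj (full a α k)) *ᵥ schurVec a z α)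
        = factor 0 (full a α) *ᵥ schurVec a z α := by
      rw [cmvAt, cmv, mulVec_mulVec, Matrix.mul_assoc, factor_full_mul_conj one_lt_two ha hα,
        Matrix.mul_one]
    rw [e]
    ext k
    rw [Pi.sub_apply, Pi.smul_apply, smul_eq_mul, factor_zero_mulVec_schurVec ha hz hα,
      factor_one_conj_mulVec_schurVec ha hz hα]
    by_cases h : k = 0
    · subst h; simp [schurDen]
    · have : k.val ≠ 0 := fun e => h (Fin.ext e)
      simp [h, this]

/-- `e₁` is cyclic: eigenvectors of a CMV matrix have a nonzero first entry. -/
theorem eigenvector_zero_ne {m : ℕ} {a ζ : ℂ} (ha : ‖a‖ = 1) (hζ : ζ ≠ 0)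
    {α : Fin m → ℂ} (hα : ∀ k, ‖α k‖ < 1) {y : Fin (m + 1) → ℂ} (hy : y ≠ 0)
    (h : cmvAt a α *ᵥ y = ζ • y) : y 0 ≠ 0 := by
  intro hy0
  apply hy
  set x := factor 1 (full a α) *ᵥ y with hx
  have hM : factor 1 (fun k => conj (full a α k)) * factor 1 (full a α) = 1 :=
    mul_eq_one_comm.1 (factor_full_mul_conj one_lt_two ha hα)
  have hyx : y = factor 1 (fun k => conj (full a α k)) *ᵥ x := by
    rw [hx, mulVec_mulVec, hM, one_mulVec]
  have hL : ∀ k, (factor 0 (full a α) *ᵥ x) k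
      = ζ * (factor 1 (fun k => conj (full a α k)) *ᵥ x) k := fun k => by
    rw [← hyx, hx, mulVec_mulVec]; exact congrFun h k
  have hρ : ∀ k (h : k < m), (rho (full a α ⟨k, by omega⟩) : ℂ) ≠ 0 := fun k h => by
    rw [full_of_lt a α h]; exact_mod_cast (rho_pos (hα _)).ne'
  -- The rows of 𝓛x = ζ𝓜*x form a three-term recursion that gives x_{k+1} from x_k and x_{k-1},
  -- after division by ρ_k, and also by ζ when k is odd.
  have hall : ∀ k (hk : k < m + 1), x ⟨k, hk⟩ = 0 := by
    intro k
    induction k using Nat.strong_induction_on with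
    | _ k ih =>
    intro hk
    rcases k with _ | k
    · have : x 0 = y 0 := by rw [hx, factor_mulVec_of_zero _ _ (by simp) (by simp)]
      exact this.trans hy0
    · have hkk := ih k (by omega) (by omega)
      have hrow := hL ⟨k, by omega⟩
      have h0 := hρ k (by omega)
      by_cases hpar : k % 2 = 0
      · rw [factor_mulVec_of_start _ _ hpar hk, hkk] at hrow
        rcases k with _ | k
        · rw [factor_mulVec_of_zero _ _ (by simp) rfl, hkk, mul_zero, mul_zero,
            zero_add] at hrow
          exact (mul_eq_zero.1 hrow).resolve_left h0
        · rw [factor_mulVec_of_end one_lt_two _ _ (by omega), hkk, ih k (by omega)] at hrow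
          simpa [h0] using hrow
      · obtain ⟨k, rfl⟩ : ∃ j, k = j + 1 := ⟨k - 1, by omega⟩
        rw [factor_mulVec_of_end two_pos _ _ (by omega), hkk, ih k (by omega),
          factor_mulVec_of_start _ _ (by simp only; omega) hk, hkk] at hrow
        simpa [h0, hζ, rho_conj] using hrow
  rw [hyx, show x = 0 from funext fun k => hall k k.2, mulVec_zero]

/-! ### Spectral decomposition of a unitary matrix with simple spectrum -/

/-- A unitary matrix preserves inner products, so (z̄w - 1)⟨u, v⟩ = 0; and z̄w = 1 with |z| = 1
would force z = w. -/
theorem inner_eq_zero_of_eigenvectors {n : ℕ} {B : Matrix (Fin n) (Fin n) ℂ} (hB : B * Bᴴ = 1)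
    {z w : ℂ} (hz : ‖z‖ = 1) (hzw : z ≠ w) {u v : EuclideanSpace ℂ (Fin n)}
    (hu : toEuclideanLin B u = z • u) (hv : toEuclideanLin B v = w • v) : inner ℂ u v = 0 := by
  have h1 : inner ℂ (toEuclideanLin B u) (toEuclideanLin B v) = inner ℂ u v := by
    rw [← LinearMap.adjoint_inner_right, ← Matrix.toEuclideanLin_conjTranspose_eq_adjoint]
    congr 1
    rw [toLpLin_apply, toLpLin_apply, mulVec_mulVec, mul_eq_one_comm.1 hB, one_mulVec]
  rw [hu, hv, inner_smul_left, inner_smul_right] at h1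
  have h2 : conj z * w - 1 ≠ 0 := fun h => hzw <| by
    have h3 := Complex.mul_conj' z
    rw [hz] at h3
    push_cast at h3
    linear_combination w * h3 - z * h
  have h4 : (conj z * w - 1) * inner ℂ u v = 0 := by linear_combination h1
  exact (mul_eq_zero.1 h4).resolve_left h2

theorem exists_unitary_diagonalization {m : ℕ} {B : Matrix (Fin (m + 1)) (Fin (m + 1)) ℂ}
    (hB : B * Bᴴ = 1) {ζ : Fin (m + 1) → ℂ} (hinj : Function.Injective ζ)
    (h1 : ∀ j, ‖ζ j‖ = 1) (hsp : ∀ j, ζ j ∈ spectrum ℂ B) :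
    ∃ W : Matrix (Fin (m + 1)) (Fin (m + 1)) ℂ, W * Wᴴ = 1 ∧ B = W * diagonal ζ * Wᴴ ∧
      ∀ j, spectralMass B (ζ j) = ‖W 0 j‖ ^ 2 := by
  have hex : ∀ j, ∃ v : EuclideanSpace ℂ (Fin (m + 1)), ‖v‖ = 1 ∧
      toEuclideanLin B v = ζ j • v := fun j => by
    have : Module.End.HasEigenvalue (toEuclideanLin B) (ζ j) := by
      rw [Module.End.hasEigenvalue_iff_mem_spectrum, spectrum_toLpLin]; exact hsp j
    obtain ⟨v, hv⟩ := this.exists_hasEigenvector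
    have hn : (‖v‖ : ℂ) ≠ 0 := by exact_mod_cast norm_ne_zero_iff.2 hv.2
    refine ⟨(‖v‖ : ℂ)⁻¹ • v, ?_, ?_⟩
    · rw [norm_smul, norm_inv, Complex.norm_real, norm_norm, inv_mul_cancel₀ (by exact_mod_cast hn)]
    · rw [map_smul, hv.apply_eq_smul, smul_comm]
  choose v hv1 hv using hex
  have hon : Orthonormal ℂ v := ⟨hv1, fun j k hjk =>
    inner_eq_zero_of_eigenvectors hB (h1 j) (hinj.ne hjk) (hv j) (hv k)⟩
  set W : Matrix (Fin (m + 1)) (Fin (m + 1)) ℂ := of fun i j => v j i with hW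
  have hWW : Wᴴ * W = 1 := by
    ext j k
    have := orthonormal_iff_ite.1 hon j k
    rw [Matrix.one_apply, ← this, PiLp.inner_apply, Matrix.mul_apply]
    exact Finset.sum_congr rfl fun i _ => by simp [hW, mul_comm]
  have hWW' : W * Wᴴ = 1 := mul_eq_one_comm.1 hWW
  have hBW : B * W = W * diagonal ζ := by
    ext i j
    have := congrArg (fun u : EuclideanSpace ℂ (Fin (m + 1)) => u i) (hv j)
    rw [mul_diagonal]
    simp only [toLpLin_apply, PiLp.smul_apply, smul_eq_mul] at this
    rw [mul_comm (W i j)]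
    exact this
  refine ⟨W, hWW', ?_, fun j => ?_⟩
  · rw [← hBW, Matrix.mul_assoc, hWW', Matrix.mul_one]
  -- The eigenspaces are lines, so projecting e₁ amounts to taking one coefficient, the conjugate of
  -- W₀ⱼ.
  · have hspan : Module.End.eigenspace (toEuclideanLin B) (ζ j) = ℂ ∙ v j := by
      ext w
      rw [Module.End.mem_eigenspace_iff, Submodule.mem_span_singleton]
      constructor
      · intro hw
        have hcard : Fintype.card (Fin (m + 1)) = Module.finrank ℂ (EuclideanSpace ℂ (Fin (m + 1))) :=
          by simp
        let b := (basisOfOrthonormalOfCardEqFinrank hon hcard).toOrthonormalBasis (by simpa using hon)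
        have hb : ∀ k, b k = v k := fun k => by simp [b]
        refine ⟨inner ℂ (v j) w, ?_⟩
        refine Eq.trans ?_ (b.sum_repr' w)
        rw [Finset.sum_eq_single j]
        · rw [hb]
        · intro k _ hk
          rw [hb, inner_eq_zero_of_eigenvectors hB (h1 k) (hinj.ne hk) (hv k) hw, zero_smul]
        · simp
      · rintro ⟨c, rfl⟩
        rw [map_smul, hv, smul_comm]
    rw [spectralMass]
    simp only [hspan]
    rw [Submodule.starProjection_unit_singleton ℂ (hv1 j), norm_smul, hv1, mul_one,
      EuclideanSpace.inner_single_right]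
    simp [hW]

theorem mul_conj_norm_sq (z : ℂ) : z * conj z = ((‖z‖ ^ 2 : ℝ) : ℂ) := by
  rw [Complex.mul_conj']; push_cast; rfl

/-- The Cauchy transform of the spectral measure as a quotient of solutions. -/
theorem apply_zero_eq_cauchy {m : ℕ} {B W : Matrix (Fin (m + 1)) (Fin (m + 1)) ℂ}
    {ζ : Fin (m + 1) → ℂ} (hW : W * Wᴴ = 1) (hB : B = W * diagonal ζ * Wᴴ) {z c : ℂ}
    (hz : ∀ j, ζ j - z ≠ 0) {y : Fin (m + 1) → ℂ} (hy : B *ᵥ y - z • y = Pi.single 0 c) :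
    y 0 = c * cauchy (fun j => ((‖W 0 j‖ ^ 2 : ℝ) : ℂ)) ζ z := by
  set u := Wᴴ *ᵥ y with hu
  have hyu : y = W *ᵥ u := by rw [hu, mulVec_mulVec, hW, one_mulVec]
  have hWB : Wᴴ *ᵥ (B *ᵥ y) = diagonal ζ *ᵥ u := by
    rw [hB, mulVec_mulVec, ← Matrix.mul_assoc, ← Matrix.mul_assoc, mul_eq_one_comm.1 hW,
      Matrix.one_mul, ← mulVec_mulVec]
  have hj : ∀ j, u j = c * conj (W 0 j) / (ζ j - z) := fun j => by
    have h := congrFun (congrArg (fun x => Wᴴ *ᵥ x) hy) j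
    simp only [mulVec_sub, mulVec_smul, hWB, ← hu, mulVec_single, Pi.sub_apply, Pi.smul_apply,
      mulVec_diagonal] at h
    rw [eq_div_iff (hz j)]
    simp at h
    linear_combination h
  rw [hyu, mulVec, dotProduct, cauchy, Finset.mul_sum]
  refine Finset.sum_congr rfl fun j _ => ?_
  rw [hj, ← mul_conj_norm_sq]
  ring

theorem det_smul_one_sub {m : ℕ} {B W : Matrix (Fin (m + 1)) (Fin (m + 1)) ℂ}
    {ζ : Fin (m + 1) → ℂ} (hW : W * Wᴴ = 1) (hB : B = W * diagonal ζ * Wᴴ) (z : ℂ) :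
    (z • (1 : Matrix (Fin (m + 1)) (Fin (m + 1)) ℂ) - B).det = ∏ j, (z - ζ j) := by
  have h : z • (1 : Matrix (Fin (m + 1)) (Fin (m + 1)) ℂ) - B
      = W * diagonal (fun j => z - ζ j) * Wᴴ := by
    have : diagonal (fun j => z - ζ j) = z • (1 : Matrix (Fin (m + 1)) (Fin (m + 1)) ℂ)
        - diagonal ζ := by
      ext i j; by_cases h : i = j <;> simp [h]
    rw [this, Matrix.mul_sub, Matrix.sub_mul, hB, Matrix.mul_smul, Matrix.mul_one, Matrix.smul_mul,
      hW]
  rw [h, det_mul, det_mul, det_diagonal, mul_right_comm, ← det_mul, hW, det_one, one_mul]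

/-- The adjugate is multiplicative even at a singular matrix, and that of a diagonal matrix with a
single zero at place j keeps only the entry j. -/
theorem adjugate_smul_one_sub {m : ℕ} {B W : Matrix (Fin (m + 1)) (Fin (m + 1)) ℂ}
    {ζ : Fin (m + 1) → ℂ} (hW : W * Wᴴ = 1) (hB : B = W * diagonal ζ * Wᴴ)
    (j : Fin (m + 1)) :
    (ζ j • (1 : Matrix (Fin (m + 1)) (Fin (m + 1)) ℂ) - B).adjugate
      = (∏ k ∈ Finset.univ.erase j, (ζ j - ζ k)) • vecMulVec (W.col j) (star (W.col j)) := by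
  have h : ζ j • (1 : Matrix (Fin (m + 1)) (Fin (m + 1)) ℂ) - B
      = W * diagonal (fun k => ζ j - ζ k) * Wᴴ := by
    have : diagonal (fun k => ζ j - ζ k) = ζ j • (1 : Matrix (Fin (m + 1)) (Fin (m + 1)) ℂ)
        - diagonal ζ := by
      ext i k; by_cases h : i = k <;> simp [h]
    rw [this, Matrix.mul_sub, Matrix.sub_mul, hB, Matrix.mul_smul, Matrix.mul_one, Matrix.smul_mul,
      hW]
  have hadj : ∀ X Y : Matrix (Fin (m + 1)) (Fin (m + 1)) ℂ, X * Y = 1 →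
      X.adjugate = X.det • Y := fun X Y hXY => by
    rw [← Matrix.mul_one X.adjugate, ← hXY, ← Matrix.mul_assoc, adjugate_mul, Matrix.smul_mul,
      Matrix.one_mul]
  have hdet : W.det * Wᴴ.det = 1 := by rw [← det_mul, hW, det_one]
  rw [h, adjugate_mul_distrib, adjugate_mul_distrib, hadj W _ hW, hadj Wᴴ W (mul_eq_one_comm.1 hW),
    Matrix.smul_mul, Matrix.mul_smul, Matrix.mul_smul, smul_smul, mul_comm, hdet, one_smul,
    adjugate_diagonal, ← Matrix.mul_assoc]
  ext i k
  rw [Matrix.mul_apply, Finset.sum_eq_single j]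
  · rw [Matrix.mul_diagonal]
    simp [vecMulVec_apply]
    ring
  · intro l _ hl
    rw [Matrix.mul_diagonal, Finset.prod_eq_zero (Finset.mem_erase.2 ⟨hl.symm, Finset.mem_univ j⟩)
      (sub_self _)]
    simp
  · simp

/-- Dividing by the trace removes the product of eigenvalue differences, so the mass becomes a
rational function of the matrix and one eigenvalue. This form makes sense off the manifold of CMV
matrices. -/
theorem norm_sq_eq_adjugate_div_trace {m : ℕ} {B W : Matrix (Fin (m + 1)) (Fin (m + 1)) ℂ}
    {ζ : Fin (m + 1) → ℂ} (hinj : Function.Injective ζ) (hW : W * Wᴴ = 1)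
    (hB : B = W * diagonal ζ * Wᴴ) (j : Fin (m + 1)) :
    (ζ j • (1 : Matrix (Fin (m + 1)) (Fin (m + 1)) ℂ) - B).adjugate.trace ≠ 0 ∧
    ((‖W 0 j‖ ^ 2 : ℝ) : ℂ)
      = (ζ j • (1 : Matrix (Fin (m + 1)) (Fin (m + 1)) ℂ) - B).adjugate 0 0
        / (ζ j • (1 : Matrix (Fin (m + 1)) (Fin (m + 1)) ℂ) - B).adjugate.trace := by
  have hp : ∏ k ∈ Finset.univ.erase j, (ζ j - ζ k) ≠ 0 :=
    Finset.prod_ne_zero_iff.2 fun k hk => sub_ne_zero.2 (hinj.ne (Finset.ne_of_mem_erase hk).symm)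
  have ht : (vecMulVec (W.col j) (star (W.col j))).trace = 1 := by
    have h := congrArg (fun X : Matrix _ _ ℂ => X j j) (mul_eq_one_comm.1 hW)
    rw [Matrix.one_apply_eq, Matrix.mul_apply] at h
    rw [← h, trace]
    exact Finset.sum_congr rfl fun i _ => by simp [vecMulVec_apply, mul_comm]
  rw [adjugate_smul_one_sub hW hB j, trace_smul, ht, smul_eq_mul, mul_one]
  refine ⟨hp, ?_⟩
  rw [← mul_conj_norm_sq, Matrix.smul_apply, smul_eq_mul, mul_div_cancel_left₀]
  · simp [vecMulVec_apply]
  · exact hp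

/-! ### The Hamiltonian vector fields of the Gelfand–Dikij bracket -/

/-- The value at `B` of the Gelfand–Dikij Hamiltonian vector field of a function with gradient
`X`. -/
def hamVec {n : ℕ} (X B : Matrix (Fin n) (Fin n) ℂ) : Matrix (Fin n) (Fin n) ℂ :=
  piA (B * X) * B - B * piA (X * B)

theorem pairing_comm {n : ℕ} (X Y : Matrix (Fin n) (Fin n) ℂ) : pairing X Y = pairing Y X := by
  rw [pairing, pairing, trace_mul_comm]

theorem pairing_sub_left {n : ℕ} (X Y Z : Matrix (Fin n) (Fin n) ℂ) :
    pairing (X - Y) Z = pairing X Z - pairing Y Z := by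
  simp [pairing, Matrix.sub_mul, trace_sub]

/-- As R = 1 - 2π_𝔞, the identity parts of the two terms cancel by cyclicity of the trace. -/
theorem gdBracket_eq_pairing_hamVec {n : ℕ} (φ ψ : Matrix (Fin n) (Fin n) ℂ → ℝ)
    (B : Matrix (Fin n) (Fin n) ℂ) :
    gdBracket φ ψ B = pairing (hamVec (grad φ B) B) (grad ψ B) := by
  set X := grad φ B with hX
  set Y := grad ψ B with hY
  have hR : ∀ Z : Matrix (Fin n) (Fin n) ℂ, R Z = Z - piA Z - piA Z := fun Z => rfl
  have h1 : pairing (X * B) (Y * B) = pairing (B * X) (B * Y) := by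
    simp only [pairing]
    rw [← Matrix.mul_assoc, trace_mul_comm, Matrix.mul_assoc, Matrix.mul_assoc]
  have h2 : pairing (piA (B * X) * B) Y = pairing (piA (B * X)) (B * Y) := by
    simp only [pairing, Matrix.mul_assoc]
  have h3 : pairing (B * piA (X * B)) Y = pairing (piA (X * B)) (Y * B) := by
    simp only [pairing]
    rw [Matrix.mul_assoc, trace_mul_comm, Matrix.mul_assoc]
  rw [gdBracket, ← hX, ← hY, hamVec, pairing_sub_left, h2, h3, hR, hR]
  simp only [pairing_sub_left]
  linarith

theorem pairing_grad {n : ℕ} (φ : Matrix (Fin n) (Fin n) ℂ → ℝ)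
    (B D : Matrix (Fin n) (Fin n) ℂ) : pairing D (grad φ B) = fderiv ℝ φ B D := by
  have hD : D = ∑ k, ∑ l, ((D k l).re • Matrix.single k l (1 : ℂ)
      + (D k l).im • Matrix.single k l Complex.I) := by
    conv_lhs => rw [matrix_eq_sum_single D]
    refine Finset.sum_congr rfl fun k _ => Finset.sum_congr rfl fun l _ => ?_
    rw [Matrix.smul_single, Matrix.smul_single, ← Matrix.single_add]
    congr 1
    apply Complex.ext <;> simp
  conv_rhs => rw [hD]
  simp only [map_sum, map_add, map_smul, smul_eq_mul]
  rw [pairing, trace, Complex.im_sum]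
  refine Finset.sum_congr rfl fun k _ => ?_
  rw [diag_apply, Matrix.mul_apply, Complex.im_sum]
  refine Finset.sum_congr rfl fun l _ => ?_
  simp [grad]

/-- A covector X at AB pulls back to BX at A and to XA at B. The terms A π_𝔞(BXA) B, which occur
with opposite signs, cancel. -/
theorem hamVec_mul {n : ℕ} (X A B : Matrix (Fin n) (Fin n) ℂ) :
    hamVec X (A * B) = hamVec (B * X) A * B + A * hamVec (X * A) B := by
  simp only [hamVec, Matrix.mul_sub, Matrix.sub_mul, Matrix.mul_assoc]
  abel

/-- The derivative of `rho` at `z` in the direction `w`. -/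
def drho (z w : ℂ) : ℝ := -(z.re * w.re + z.im * w.im) / rho z

/-- The derivative of `factor p` at `A` in the direction `w`. -/
def dfactor {n : ℕ} (p : ℕ) (A w : Fin n → ℂ) : Matrix (Fin n) (Fin n) ℂ :=
  Matrix.of fun i j =>
    if i = j then
      if i.val % 2 = p then conj (w i)
      else if i.val = 0 then 0
      else -w ⟨i.val - 1, by omega⟩
    else if i.val + 1 = j.val ∧ i.val % 2 = p then (drho (A i) (w i) : ℂ)
    else if j.val + 1 = i.val ∧ j.val % 2 = p then (drho (A j) (w j) : ℂ)
    else 0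

theorem drho_zero (z : ℂ) : drho z 0 = 0 := by simp [drho]

theorem dfactor_single_of_ne {n p : ℕ} (_hp : p < 2) (A : Fin n → ℂ) {j : Fin n}
    (hj : j.val % 2 ≠ p) (v : ℂ) : dfactor p A (Pi.single j v) = 0 := by
  have hz : ∀ i : Fin n, i.val % 2 = p → (Pi.single j v : Fin n → ℂ) i = 0 := fun i hi => by
    rw [Pi.single_eq_of_ne]; rintro rfl; exact hj hi
  ext i k
  simp only [dfactor, of_apply, Matrix.zero_apply]
  split_ifs with h1 h2 h3 h4 h5
  · rw [hz i h2, map_zero]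
  · rfl
  · rw [hz _ (by simp only; omega), neg_zero]
  · rw [hz _ h4.2, drho_zero, Complex.ofReal_zero]
  · rw [hz _ h5.2, drho_zero, Complex.ofReal_zero]
  · rfl

theorem dfactor_single {n p : ℕ} (_hp : p < 2) (A : Fin n → ℂ) {s : ℕ} (hs : s % 2 = p)
    (h : s + 1 < n) (v : ℂ) :
    dfactor p A (Pi.single ⟨s, by omega⟩ v)
      = Matrix.single ⟨s, by omega⟩ ⟨s, by omega⟩ (conj v)
        + Matrix.single ⟨s, by omega⟩ ⟨s + 1, h⟩ (drho (A ⟨s, by omega⟩) v : ℂ)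
        + Matrix.single ⟨s + 1, h⟩ ⟨s, by omega⟩ (drho (A ⟨s, by omega⟩) v : ℂ)
        + Matrix.single ⟨s + 1, h⟩ ⟨s + 1, h⟩ (-v) := by
  ext ⟨i, hi⟩ ⟨k, hk⟩
  simp only [dfactor, of_apply, Matrix.add_apply, Matrix.single_apply, Fin.mk.injEq,
    Pi.single_apply]
  by_cases hik : i = k
  · subst hik
    by_cases h1 : i = s
    · subst h1; simp [hs]
    · by_cases h2 : i = s + 1
      · subst h2
        simp [show ¬ (s + 1) % 2 = p by omega]
      · have h3 : ¬ (i ≠ 0 ∧ i - 1 = s) := by omega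
        simp only [h1, Ne.symm h1, Ne.symm h2, false_and, if_false, map_zero, if_true, add_zero]
        split_ifs with h4 h5 h6
        · rfl
        · rfl
        · exact absurd ⟨h5, h6⟩ h3
        · exact neg_zero
  · rw [if_neg hik]
    by_cases h1 : i + 1 = k ∧ i % 2 = p
    · rw [if_pos h1]
      by_cases h2 : i = s
      · subst h2; simp [← h1.1]
      · simp only [h2, Ne.symm h2, if_false, false_and, drho_zero]
        rw [if_neg (by omega), if_neg (by omega)]
        simp
    · rw [if_neg h1]
      by_cases h2 : k + 1 = i ∧ k % 2 = p
      · rw [if_pos h2]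
        by_cases h3 : k = s
        · subst h3; simp [← h2.1]
        · simp only [h3, Ne.symm h3, if_false, and_false, drho_zero]
          rw [if_neg (by omega), if_neg (by omega)]
          simp
      · rw [if_neg h2, if_neg (by omega), if_neg (by omega), if_neg (by omega), if_neg (by omega)]
        simp

theorem pairing_dfactor_single {n p : ℕ} (hp : p < 2) (A : Fin n → ℂ)
    (X : Matrix (Fin n) (Fin n) ℂ) {s : ℕ} (hs : s % 2 = p)
    (h : s + 1 < n) (v : ℂ) :
    pairing X (dfactor p A (Pi.single ⟨s, by omega⟩ v))
      = (X ⟨s, by omega⟩ ⟨s, by omega⟩ * conj v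
        + (X ⟨s, by omega⟩ ⟨s + 1, h⟩ + X ⟨s + 1, h⟩ ⟨s, by omega⟩)
          * (drho (A ⟨s, by omega⟩) v : ℂ)
        - X ⟨s + 1, h⟩ ⟨s + 1, h⟩ * v).im := by
  rw [dfactor_single hp A hs h, pairing]
  congr 1
  simp only [Matrix.mul_add, trace_add, trace_mul_single, op_smul_eq_mul]
  ring

/-- The Ablowitz–Ladik vector field of a function with gradient `X`, where `D j v` is the partial
derivative of the matrix in the direction `v` of the `j`-th coordinate. -/
def alVec {n : ℕ} (A : Fin n → ℂ) (D : Fin n → ℂ → Matrix (Fin n) (Fin n) ℂ)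
    (X : Matrix (Fin n) (Fin n) ℂ) : Matrix (Fin n) (Fin n) ℂ :=
  ∑ j, (rho (A j) ^ 2) • (pairing X (D j 1) • D j Complex.I - pairing X (D j Complex.I) • D j 1)

/-! ### Agreement of the two vector fields, block by block -/

theorem factor_apply_of_block_ne {n p : ℕ} (_hp : p < 2) (A : Fin n → ℂ) {i k : Fin n}
    (h : (i.val + p) / 2 ≠ (k.val + p) / 2) : factor p A i k = 0 := by
  have h1 : i ≠ k := by rintro rfl; exact h rfl
  simp only [factor, of_apply, h1, if_false]
  rw [if_neg (by omega), if_neg (by omega)]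

theorem dfactor_apply_of_block_ne {n p : ℕ} (_hp : p < 2) (A w : Fin n → ℂ) {i k : Fin n}
    (h : (i.val + p) / 2 ≠ (k.val + p) / 2) : dfactor p A w i k = 0 := by
  have h1 : i ≠ k := by rintro rfl; exact h rfl
  simp only [dfactor, of_apply, h1, if_false]
  rw [if_neg (by omega), if_neg (by omega)]

theorem piA_apply_of_lt {n : ℕ} (X : Matrix (Fin n) (Fin n) ℂ) {i j : Fin n} (h : i < j) :
    piA X i j = X i j := by simp [piA, h]

theorem piA_apply_of_gt {n : ℕ} (X : Matrix (Fin n) (Fin n) ℂ) {i j : Fin n} (h : j < i) :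
    piA X i j = -conj (X j i) := by simp [piA, h.not_gt, h.ne']

theorem piA_apply_self {n : ℕ} (X : Matrix (Fin n) (Fin n) ℂ) (i : Fin n) :
    piA X i i = ((X i i).im : ℂ) * Complex.I := by simp [piA]

/-- The number (i + p)/2 is that of the block containing i. Above the block diagonal π_𝔞 acts as the
identity, so both terms of the field equal F X F. -/
theorem hamVec_factor_apply_of_block_lt {n p : ℕ} (hp : p < 2) (A : Fin n → ℂ)
    (X : Matrix (Fin n) (Fin n) ℂ) {i k : Fin n} (h : (i.val + p) / 2 < (k.val + p) / 2) :
    hamVec X (factor p A) i k = 0 := by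
  have h1 : (piA (factor p A * X) * factor p A) i k = (factor p A * X * factor p A) i k := by
    rw [Matrix.mul_apply, Matrix.mul_apply]
    refine Finset.sum_congr rfl fun l _ => ?_
    by_cases hl : (l.val + p) / 2 = (k.val + p) / 2
    · rw [piA_apply_of_lt _ (Fin.lt_def.2 (by omega))]
    · rw [factor_apply_of_block_ne hp A hl, mul_zero, mul_zero]
  have h2 : (factor p A * piA (X * factor p A)) i k = (factor p A * (X * factor p A)) i k := by
    rw [Matrix.mul_apply, Matrix.mul_apply]
    refine Finset.sum_congr rfl fun l _ => ?_
    by_cases hl : (i.val + p) / 2 = (l.val + p) / 2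
    · rw [piA_apply_of_lt _ (Fin.lt_def.2 (by omega))]
    · rw [factor_apply_of_block_ne hp A hl, zero_mul, zero_mul]
  rw [hamVec, Matrix.sub_apply, h1, h2, Matrix.mul_assoc, sub_self]

/-- Below the block diagonal π_𝔞 is minus the adjoint, and unitarity of F turns both terms of the
field into -X*. -/
theorem hamVec_factor_apply_of_block_gt {n p : ℕ} (hp : p < 2) {A : Fin n → ℂ}
    (hA : factor p A * (factor p A)ᴴ = 1)
    (X : Matrix (Fin n) (Fin n) ℂ) {i k : Fin n} (h : (k.val + p) / 2 < (i.val + p) / 2) :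
    hamVec X (factor p A) i k = 0 := by
  have h1 : (piA (factor p A * X) * factor p A) i k = (-(factor p A * X)ᴴ * factor p A) i k := by
    rw [Matrix.mul_apply, Matrix.mul_apply]
    refine Finset.sum_congr rfl fun l _ => ?_
    by_cases hl : (l.val + p) / 2 = (k.val + p) / 2
    · rw [piA_apply_of_gt _ (Fin.lt_def.2 (by omega))]; rfl
    · rw [factor_apply_of_block_ne hp A hl, mul_zero, mul_zero]
  have h2 : (factor p A * piA (X * factor p A)) i k = (factor p A * -(X * factor p A)ᴴ) i k := by
    rw [Matrix.mul_apply, Matrix.mul_apply]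
    refine Finset.sum_congr rfl fun l _ => ?_
    by_cases hl : (i.val + p) / 2 = (l.val + p) / 2
    · rw [piA_apply_of_gt _ (Fin.lt_def.2 (by omega))]; rfl
    · rw [factor_apply_of_block_ne hp A hl, zero_mul, zero_mul]
  rw [hamVec, Matrix.sub_apply, h1, h2, conjTranspose_mul, conjTranspose_mul, Matrix.neg_mul,
    Matrix.mul_neg, Matrix.mul_assoc, mul_eq_one_comm.1 hA, ← Matrix.mul_assoc, hA,
    Matrix.one_mul, Matrix.mul_one, sub_self]

theorem factor_mul_apply {n : ℕ} (p : ℕ) (A : Fin n → ℂ) (Y : Matrix (Fin n) (Fin n) ℂ)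
    (i k : Fin n) : (factor p A * Y) i k = (factor p A *ᵥ fun l => Y l k) i := rfl

theorem mul_factor_apply {n : ℕ} (p : ℕ) (A : Fin n → ℂ) (Y : Matrix (Fin n) (Fin n) ℂ)
    (i k : Fin n) : (Y * factor p A) i k = (factor p A *ᵥ fun l => Y i l) k := by
  conv_lhs => rw [← factor_transpose p A]
  rw [Matrix.mul_apply, mulVec, dotProduct]
  exact Finset.sum_congr rfl fun l _ => by rw [transpose_apply, mul_comm]

theorem dfactor_single_apply_eq_zero {n p : ℕ} (hp : p < 2) (A : Fin n → ℂ) {i j k : Fin n} {s : ℕ}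
    (hs : s % 2 = p) (hi : i.val = s ∨ i.val = s + 1 ∨ (i.val = 0 ∧ p = 1)) (hj : j.val ≠ s)
    (v : ℂ) : dfactor p A (Pi.single j v) i k = 0 := by
  by_cases hjp : j.val % 2 = p
  · have hz : ∀ l : Fin n, l.val ≠ j.val → (Pi.single j v : Fin n → ℂ) l = 0 := fun l hl => by
      rw [Pi.single_eq_of_ne]; rintro rfl; exact hl rfl
    simp only [dfactor, of_apply]
    split_ifs with h1 h2 h3 h4 h5
    · rw [hz _ (by omega), map_zero]
    · rfl
    · rw [hz _ (by simp only; omega), neg_zero]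
    · rw [hz _ (by omega), drho_zero, Complex.ofReal_zero]
    · rw [hz _ (by omega), drho_zero, Complex.ofReal_zero]
    · rfl
  · rw [dfactor_single_of_ne hp A hjp, Matrix.zero_apply]

theorem alVec_apply {n : ℕ} (A : Fin n → ℂ) (D : Fin n → ℂ → Matrix (Fin n) (Fin n) ℂ)
    (X : Matrix (Fin n) (Fin n) ℂ) (i k : Fin n) :
    alVec A D X i k = ∑ j, (rho (A j) : ℂ) ^ 2 * ((pairing X (D j 1) : ℂ) * D j Complex.I i k
      - (pairing X (D j Complex.I) : ℂ) * D j 1 i k) := by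
  simp only [alVec, Matrix.sum_apply, Matrix.smul_apply, Matrix.sub_apply, Complex.real_smul,
    Complex.ofReal_pow]

theorem alVec_dfactor_apply {n p : ℕ} (hp : p < 2) (A : Fin n → ℂ)
    (X : Matrix (Fin n) (Fin n) ℂ) {i k : Fin n} {s : ℕ} (hsn : s < n)
    (hs : s % 2 = p) (hi : i.val = s ∨ i.val = s + 1) :
    alVec A (fun j v => dfactor p A (Pi.single j v)) X i k
      = (rho (A ⟨s, hsn⟩) : ℂ) ^ 2 *
        ((pairing X (dfactor p A (Pi.single ⟨s, hsn⟩ 1)) : ℂ)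
            * dfactor p A (Pi.single ⟨s, hsn⟩ Complex.I) i k
          - (pairing X (dfactor p A (Pi.single ⟨s, hsn⟩ Complex.I)) : ℂ)
            * dfactor p A (Pi.single ⟨s, hsn⟩ 1) i k) := by
  rw [alVec_apply, Finset.sum_eq_single ⟨s, hsn⟩]
  · intro j _ hj
    have hj' : j.val ≠ s := fun e => hj (Fin.ext e)
    have hi' : i.val = s ∨ i.val = s + 1 ∨ (i.val = 0 ∧ p = 1) := by omega
    simp only [dfactor_single_apply_eq_zero hp A hs hi' hj', mul_zero, sub_self]
  · simp

section Block

variable {γ x y z w : ℂ} {r : ℝ}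

/-- The four entries of the 2 × 2 comparison: x, y, z, w are the entries of X in the block, r is ρ,
and the quotients by r are the derivatives of ρ in the directions 1 and i. The weight r² clears
their denominators. -/
theorem hamVec_block_start_start (h0 : r ≠ 0) :
    conj γ * ((conj γ * x + r * z).im * Complex.I) + r * (conj γ * y + r * w)
      - (conj γ * ((conj γ * x + r * y).im * Complex.I) + r * -conj (r * x - γ * y))
    = (r : ℂ) ^ 2 * (((x * conj 1 + (y + z) * ((-(γ.re * (1 : ℂ).re + γ.im * (1 : ℂ).im) / r : ℝ) : ℂ)
          - w * 1).im : ℂ) * conj Complex.I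
        - ((x * conj Complex.I
          + (y + z) * ((-(γ.re * Complex.I.re + γ.im * Complex.I.im) / r : ℝ) : ℂ)
          - w * Complex.I).im : ℂ) * conj 1) := by
  apply Complex.ext <;> simp [pow_two] <;> field_simp <;> grind

theorem hamVec_block_start_end (h0 : r ≠ 0) (_hr : r ^ 2 = 1 - γ.re ^ 2 - γ.im ^ 2) :
    r * ((conj γ * x + r * z).im * Complex.I) - γ * (conj γ * y + r * w)
      - (conj γ * (r * x - γ * y) + r * ((r * z - γ * w).im * Complex.I))
    = (r : ℂ) ^ 2 * (((x * conj 1 + (y + z) * ((-(γ.re * (1 : ℂ).re + γ.im * (1 : ℂ).im) / r : ℝ) : ℂ)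
          - w * 1).im : ℂ) * ((-(γ.re * Complex.I.re + γ.im * Complex.I.im) / r : ℝ) : ℂ)
        - ((x * conj Complex.I
          + (y + z) * ((-(γ.re * Complex.I.re + γ.im * Complex.I.im) / r : ℝ) : ℂ)
          - w * Complex.I).im : ℂ) * ((-(γ.re * (1 : ℂ).re + γ.im * (1 : ℂ).im) / r : ℝ) : ℂ)) := by
  apply Complex.ext <;> simp [pow_two] <;> field_simp <;> grind

theorem hamVec_block_end_start (h0 : r ≠ 0) (_hr : r ^ 2 = 1 - γ.re ^ 2 - γ.im ^ 2) :
    conj γ * -conj (conj γ * y + r * w) + r * ((r * y - γ * w).im * Complex.I)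
      - (r * ((conj γ * x + r * y).im * Complex.I) - γ * -conj (r * x - γ * y))
    = (r : ℂ) ^ 2 * (((x * conj 1 + (y + z) * ((-(γ.re * (1 : ℂ).re + γ.im * (1 : ℂ).im) / r : ℝ) : ℂ)
          - w * 1).im : ℂ) * ((-(γ.re * Complex.I.re + γ.im * Complex.I.im) / r : ℝ) : ℂ)
        - ((x * conj Complex.I
          + (y + z) * ((-(γ.re * Complex.I.re + γ.im * Complex.I.im) / r : ℝ) : ℂ)
          - w * Complex.I).im : ℂ) * ((-(γ.re * (1 : ℂ).re + γ.im * (1 : ℂ).im) / r : ℝ) : ℂ)) := by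
  apply Complex.ext <;> simp [pow_two] <;> field_simp <;> grind

theorem hamVec_block_end_end (h0 : r ≠ 0) :
    r * -conj (conj γ * y + r * w) - γ * ((r * y - γ * w).im * Complex.I)
      - (r * (r * x - γ * y) - γ * ((r * z - γ * w).im * Complex.I))
    = (r : ℂ) ^ 2 * (((x * conj 1 + (y + z) * ((-(γ.re * (1 : ℂ).re + γ.im * (1 : ℂ).im) / r : ℝ) : ℂ)
          - w * 1).im : ℂ) * (-Complex.I)
        - ((x * conj Complex.I
          + (y + z) * ((-(γ.re * Complex.I.re + γ.im * Complex.I.im) / r : ℝ) : ℂ)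
          - w * Complex.I).im : ℂ) * (-1)) := by
  apply Complex.ext <;> simp [pow_two] <;> field_simp <;> grind

end Block

theorem rho_sq_re_im {z : ℂ} (hz : ‖z‖ ≤ 1) : rho z ^ 2 = 1 - z.re ^ 2 - z.im ^ 2 := by
  rw [rho, Real.sq_sqrt (by nlinarith [norm_nonneg z]), ← Complex.normSq_eq_norm_sq,
    Complex.normSq_apply]
  ring

theorem hamVec_factor_apply_of_block {n p : ℕ} (hp : p < 2) {A : Fin n → ℂ}
    (X : Matrix (Fin n) (Fin n) ℂ) {s : ℕ} (hs : s % 2 = p) (h : s + 1 < n)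
    (hA : ‖A ⟨s, by omega⟩‖ < 1) {i k : Fin n} (hi : i.val = s ∨ i.val = s + 1)
    (hk : k.val = s ∨ k.val = s + 1) :
    hamVec X (factor p A) i k = alVec A (fun j v => dfactor p A (Pi.single j v)) X i k := by
  have hsn : s < n := by omega
  have h0 : rho (A ⟨s, hsn⟩) ≠ 0 := (rho_pos hA).ne'
  have hr := rho_sq_re_im (z := A ⟨s, hsn⟩) hA.le
  have hlt : (⟨s, hsn⟩ : Fin n) < ⟨s + 1, h⟩ := by simp [Fin.lt_def]
  have e1 : ∀ y, (factor p A *ᵥ y) ⟨s, hsn⟩ = _ := fun y =>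
    factor_mulVec_of_start A y (i := ⟨s, hsn⟩) hs h
  have e2 : ∀ y, (factor p A *ᵥ y) ⟨s + 1, h⟩ = _ := fun y => factor_mulVec_of_end hp A y hs h
  simp only at e1
  have d11 : ∀ v, dfactor p A (Pi.single ⟨s, hsn⟩ v) ⟨s, hsn⟩ ⟨s, hsn⟩ = conj v := fun v => by
    rw [dfactor_single hp A hs h]; simp
  have d12 : ∀ v, dfactor p A (Pi.single ⟨s, hsn⟩ v) ⟨s, hsn⟩ ⟨s + 1, h⟩
      = drho (A ⟨s, hsn⟩) v := fun v => by
    rw [dfactor_single hp A hs h]; simp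
  have d21 : ∀ v, dfactor p A (Pi.single ⟨s, hsn⟩ v) ⟨s + 1, h⟩ ⟨s, hsn⟩
      = drho (A ⟨s, hsn⟩) v := fun v => by
    rw [dfactor_single hp A hs h]; simp
  have d22 : ∀ v, dfactor p A (Pi.single ⟨s, hsn⟩ v) ⟨s + 1, h⟩ ⟨s + 1, h⟩ = -v := fun v => by
    rw [dfactor_single hp A hs h]; simp
  rw [alVec_dfactor_apply hp A X hsn hs hi, pairing_dfactor_single hp A X hs h,
    pairing_dfactor_single hp A X hs h, hamVec, Matrix.sub_apply, mul_factor_apply,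
    factor_mul_apply]
  have hi' : i = ⟨s, hsn⟩ ∨ i = ⟨s + 1, h⟩ := hi.imp Fin.ext Fin.ext
  have hk' : k = ⟨s, hsn⟩ ∨ k = ⟨s + 1, h⟩ := hk.imp Fin.ext Fin.ext
  rcases hi' with rfl | rfl <;> rcases hk' with rfl | rfl
  · rw [e1, e1]
    simp only [piA_apply_self, piA_apply_of_lt _ hlt, piA_apply_of_gt _ hlt, factor_mul_apply,
      mul_factor_apply, e1, e2, d11, drho]
    exact hamVec_block_start_start h0
  · rw [e2, e1]
    simp only [piA_apply_self, piA_apply_of_lt _ hlt, factor_mul_apply,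
      mul_factor_apply, e1, e2, d12, drho]
    exact hamVec_block_start_end h0 hr
  · rw [e1, e2]
    simp only [piA_apply_self, piA_apply_of_gt _ hlt, factor_mul_apply,
      mul_factor_apply, e1, e2, d21, drho]
    exact hamVec_block_end_start h0 hr
  · rw [e2, e2]
    simp only [piA_apply_self, piA_apply_of_lt _ hlt, piA_apply_of_gt _ hlt, factor_mul_apply,
      mul_factor_apply, e1, e2, d22, drho]
    exact hamVec_block_end_end h0

/-- On a block-diagonal factor of a CMV matrix the Gelfand–Dikij and Ablowitz–Ladik vector fields
agree. -/
theorem hamVec_factor {n p : ℕ} (hp : p < 2) {A : Fin n → ℂ}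
    (hA : ∀ k : Fin n, k.val + 1 < n → ‖A k‖ < 1)
    (hlast : ∀ k : Fin n, ¬ k.val + 1 < n → ‖A k‖ = 1) (X : Matrix (Fin n) (Fin n) ℂ) :
    hamVec X (factor p A) = alVec A (fun j v => dfactor p A (Pi.single j v)) X := by
  have hA' : ∀ k, ‖A k‖ ≤ 1 := fun k => by
    by_cases h : k.val + 1 < n
    · exact (hA k h).le
    · exact (hlast k h).le
  have hunit : factor p A * (factor p A)ᴴ = 1 := by
    rw [factor_conjTranspose]; exact factor_mul_factor_conj hp hA' hlast
  ext i k
  rcases lt_trichotomy ((i.val + p) / 2) ((k.val + p) / 2) with hb | hb | hb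
  · rw [hamVec_factor_apply_of_block_lt hp A X hb, alVec_apply]
    simp only [dfactor_apply_of_block_ne hp A _ hb.ne, mul_zero, sub_self, Finset.sum_const_zero]
  · by_cases hi : i.val % 2 = p
    · by_cases h : i.val + 1 < n
      · exact hamVec_factor_apply_of_block hp X hi h (hA i h) (Or.inl rfl) (by omega)
      · obtain rfl : k = i := Fin.ext (by omega)
        -- In the last 1 × 1 block the Ablowitz–Ladik field vanishes as ρ = 0, and the Gelfand–Dikij
        -- field because scalars commute.
        have hρ : rho (A k) = 0 := by simp [rho, hlast k h]
        rw [alVec_dfactor_apply hp A X k.2 hi (Or.inl rfl), hρ, hamVec, Matrix.sub_apply,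
          mul_factor_apply, factor_mul_apply, factor_mulVec_of_last A _ hi h,
          factor_mulVec_of_last A _ hi h, piA_apply_self, piA_apply_self, factor_mul_apply,
          mul_factor_apply, factor_mulVec_of_last A _ hi h, factor_mulVec_of_last A _ hi h]
        simp
    · by_cases h : i.val = 0
      · obtain rfl : k = i := Fin.ext (by omega)
        rw [hamVec, Matrix.sub_apply,
          mul_factor_apply, factor_mul_apply, factor_mulVec_of_zero A _ hi h,
          factor_mulVec_of_zero A _ hi h, piA_apply_self, piA_apply_self, factor_mul_apply,
          mul_factor_apply, factor_mulVec_of_zero A _ hi h, factor_mulVec_of_zero A _ hi h,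
          sub_self, alVec_apply]
        refine (Finset.sum_eq_zero fun j _ => ?_).symm
        have hz : ∀ v, dfactor p A (Pi.single j v) k k = 0 := fun v => by
          simp only [dfactor, of_apply, if_true, if_neg hi, if_pos h]
        rw [hz, hz, mul_zero, mul_zero, sub_self, mul_zero]
      · obtain ⟨s, hs⟩ : ∃ s, i.val = s + 1 := ⟨i.val - 1, by omega⟩
        have hsn : s + 1 < n := hs ▸ i.2
        exact hamVec_factor_apply_of_block hp X (s := s) (by omega) hsn (hA _ hsn) (Or.inr hs)
          (by omega)
  · rw [hamVec_factor_apply_of_block_gt hp hunit X hb, alVec_apply]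
    simp only [dfactor_apply_of_block_ne hp A _ hb.ne', mul_zero, sub_self, Finset.sum_const_zero]

/-- The derivative of `cmv` at `A` in the direction `w`. -/
def dcmv {n : ℕ} (A w : Fin n → ℂ) : Matrix (Fin n) (Fin n) ℂ :=
  dfactor 0 A w * factor 1 A + factor 0 A * dfactor 1 A w

/-- Multiplication by a fixed matrix moves across the pairing, so the field of the pulled-back
covector is that of the product. -/
theorem alVec_mul_right {n : ℕ} (A : Fin n → ℂ) (D : Fin n → ℂ → Matrix (Fin n) (Fin n) ℂ)
    (X B : Matrix (Fin n) (Fin n) ℂ) :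
    alVec A D (B * X) * B = alVec A (fun j v => D j v * B) X := by
  have hp : ∀ Y, pairing (B * X) Y = pairing X (Y * B) := fun Y => by
    rw [pairing, pairing, Matrix.mul_assoc, trace_mul_comm, Matrix.mul_assoc]
  simp only [alVec, Finset.sum_mul, Matrix.smul_mul, Matrix.sub_mul, hp]

theorem alVec_mul_left {n : ℕ} (A : Fin n → ℂ) (D : Fin n → ℂ → Matrix (Fin n) (Fin n) ℂ)
    (X B : Matrix (Fin n) (Fin n) ℂ) :
    B * alVec A D (X * B) = alVec A (fun j v => B * D j v) X := by
  have hp : ∀ Y, pairing (X * B) Y = pairing X (B * Y) := fun Y => by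
    rw [pairing, pairing, Matrix.mul_assoc]
  simp only [alVec, Finset.mul_sum, Matrix.mul_smul, Matrix.mul_sub, hp]

/-- Each parameter enters exactly one of 𝓛 and 𝓜, so for each j only one of the two summands in the
derivative of the product is nonzero and no mixed terms arise. -/
theorem hamVec_cmv {n : ℕ} {A : Fin n → ℂ} (hA : ∀ k : Fin n, k.val + 1 < n → ‖A k‖ < 1)
    (hlast : ∀ k : Fin n, ¬ k.val + 1 < n → ‖A k‖ = 1) (X : Matrix (Fin n) (Fin n) ℂ) :
    hamVec X (cmv A) = alVec A (fun j v => dcmv A (Pi.single j v)) X := by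
  rw [cmv, hamVec_mul, hamVec_factor two_pos hA hlast, hamVec_factor one_lt_two hA hlast,
    alVec_mul_right, alVec_mul_left, alVec, alVec, alVec, ← Finset.sum_add_distrib]
  refine Finset.sum_congr rfl fun j _ => ?_
  have h0 : ∀ Y : Matrix (Fin n) (Fin n) ℂ, pairing Y 0 = 0 := fun Y => by simp [pairing]
  by_cases hj : j.val % 2 = 0
  · have hz : ∀ v, dfactor 1 A (Pi.single j v) = 0 :=
      dfactor_single_of_ne one_lt_two A (by omega)
    simp [dcmv, hz, h0]
  · have hz : ∀ v, dfactor 0 A (Pi.single j v) = 0 := dfactor_single_of_ne two_pos A hj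
    simp [dcmv, hz, h0]

/-! ### Smoothness of the CMV parametrization; the two brackets agree -/

theorem contDiffAt_matrix {𝕜 E : Type*} [NontriviallyNormedField 𝕜] [NormedAddCommGroup E]
    [NormedSpace 𝕜 E] [NormedAlgebra 𝕜 ℂ] {k : WithTop ℕ∞} {n : ℕ}
    {F : E → Matrix (Fin n) (Fin n) ℂ} {x : E}
    (h : ∀ i j, ContDiffAt 𝕜 k (fun y => F y i j) x) : ContDiffAt 𝕜 k F x :=
  contDiffAt_pi.2 fun i => contDiffAt_pi.2 fun j => h i j

theorem hasDerivAt_matrix {n : ℕ} {F : ℝ → Matrix (Fin n) (Fin n) ℂ}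
    {F' : Matrix (Fin n) (Fin n) ℂ} {t : ℝ}
    (h : ∀ i j, HasDerivAt (fun s => F s i j) (F' i j) t) : HasDerivAt F F' t :=
  hasDerivAt_pi.2 fun i => hasDerivAt_pi.2 fun j => h i j

theorem HasDerivAt.matrix_apply {n : ℕ} {F : ℝ → Matrix (Fin n) (Fin n) ℂ}
    {F' : Matrix (Fin n) (Fin n) ℂ} {t : ℝ} (h : HasDerivAt F F' t) (i j : Fin n) :
    HasDerivAt (fun s => F s i j) (F' i j) t :=
  hasDerivAt_pi.1 (hasDerivAt_pi.1 h i) j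

theorem hasDerivAt_matrix_mul {n : ℕ} {F G : ℝ → Matrix (Fin n) (Fin n) ℂ}
    {F' G' : Matrix (Fin n) (Fin n) ℂ} {t : ℝ} (hF : HasDerivAt F F' t) (hG : HasDerivAt G G' t) :
    HasDerivAt (fun s => F s * G s) (F' * G t + F t * G') t := by
  refine hasDerivAt_matrix fun i j => ?_
  simp only [Matrix.add_apply, Matrix.mul_apply, ← Finset.sum_add_distrib]
  exact HasDerivAt.fun_sum fun l _ => (HasDerivAt.matrix_apply hF i l).mul
    (HasDerivAt.matrix_apply hG l j)

theorem norm_sq_re_im (z : ℂ) : ‖z‖ ^ 2 = z.re ^ 2 + z.im ^ 2 := by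
  rw [← Complex.normSq_eq_norm_sq, Complex.normSq_apply]; ring

theorem contDiffAt_rho {z : ℂ} (hz : ‖z‖ < 1) : ContDiffAt ℝ ∞ rho z := by
  have h : 1 - ‖z‖ ^ 2 ≠ 0 := by nlinarith [norm_nonneg z]
  exact (Real.contDiffAt_sqrt h).comp z (contDiffAt_const.sub (contDiff_norm_sq ℝ).contDiffAt)

theorem hasDerivAt_rho_line {z : ℂ} (hz : ‖z‖ < 1) (w : ℂ) :
    HasDerivAt (fun t : ℝ => rho (z + t • w)) (drho z w) 0 := by
  have h : 1 - ((z.re + 0 * w.re) ^ 2 + (z.im + 0 * w.im) ^ 2) ≠ 0 := by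
    have := norm_sq_re_im z
    nlinarith [norm_nonneg z]
  have hl : ∀ x y : ℝ, HasDerivAt (fun t : ℝ => (x + t * y) ^ 2) (2 * x * y) 0 := fun x y => by
    refine (((((hasDerivAt_id (0 : ℝ)).mul_const y).const_add x)).pow 2).congr_deriv ?_
    simp
  have h1 := (((hl z.re w.re).add (hl z.im w.im)).const_sub 1).sqrt h
  have e : (fun t : ℝ => rho (z + t • w)) = fun t : ℝ =>
      √(1 - ((z.re + t * w.re) ^ 2 + (z.im + t * w.im) ^ 2)) := by
    funext t
    rw [rho, norm_sq_re_im]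
    simp
  rw [e]
  refine h1.congr_deriv ?_
  have : √(1 - ((z.re + 0 * w.re) ^ 2 + (z.im + 0 * w.im) ^ 2)) = rho z := by
    rw [rho, norm_sq_re_im]; simp
  rw [Pi.add_apply, this, drho]
  field_simp

theorem hasDerivAt_factor_line {n : ℕ} (p : ℕ) {A : Fin n → ℂ} (w : Fin n → ℂ)
    (hA : ∀ k : Fin n, k.val + 1 < n → ‖A k‖ < 1) :
    HasDerivAt (fun t : ℝ => factor p (A + t • w)) (dfactor p A w) 0 := by
  have hl : ∀ k, HasDerivAt (fun t : ℝ => (A + t • w) k) (w k) 0 := fun k => by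
    have := ((hasDerivAt_id (0 : ℝ)).smul_const (w k)).const_add (A k)
    rw [one_smul] at this
    exact this
  have hr : ∀ k : Fin n, k.val + 1 < n →
      HasDerivAt (fun t : ℝ => (rho ((A + t • w) k) : ℂ)) (drho (A k) (w k) : ℂ) 0 := fun k hk =>
    (hasDerivAt_rho_line (hA k hk) (w k)).ofReal_comp
  refine hasDerivAt_matrix fun i j => ?_
  simp only [factor, dfactor, of_apply]
  split_ifs with h1 h2 h3 h4 h5
  · exact (Complex.conjCLE : ℂ →L[ℝ] ℂ).hasFDerivAt.comp_hasDerivAt 0 (hl i)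
  · exact hasDerivAt_const _ _
  · exact (hl _).neg
  · exact hr i (by omega)
  · exact hr j (by omega)
  · exact hasDerivAt_const _ _

theorem full_add_smul {m : ℕ} (a : ℂ) (α v : Fin m → ℂ) (t : ℝ) :
    full a (α + t • v) = full a α + t • full 0 v := by
  funext k
  obtain ⟨k, hk⟩ := k
  by_cases h : k < m
  · rw [full_of_lt a _ h, Pi.add_apply, Pi.add_apply, Pi.smul_apply, Pi.smul_apply,
      full_of_lt a _ h, full_of_lt 0 _ h]
  · obtain rfl : k = m := by omega
    rw [full_last, Pi.add_apply, Pi.smul_apply, full_last, full_last, smul_zero, add_zero]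

theorem full_zero_single {m : ℕ} (j : Fin m) (v : ℂ) :
    full 0 (Pi.single j v) = Pi.single j.castSucc v := by
  funext k
  refine Fin.lastCases ?_ (fun k => ?_) k
  · rw [Pi.single_eq_of_ne (Fin.castSucc_lt_last j).ne']; simp [full]
  · simp [full, Pi.single_apply]

theorem norm_full_lt {m : ℕ} (a : ℂ) {α : Fin m → ℂ} (hα : ∀ k, ‖α k‖ < 1)
    (k : Fin (m + 1)) (hk : k.val + 1 < m + 1) : ‖full a α k‖ < 1 := by
  obtain ⟨k, hk'⟩ := k
  rw [full_of_lt a α (by simpa using hk)]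
  exact hα _

theorem contDiffAt_full {m : ℕ} (a : ℂ) (α : Fin m → ℂ) (k : Fin (m + 1)) :
    ContDiffAt ℝ ∞ (fun β : Fin m → ℂ => full a β k) α := by
  obtain ⟨k, hk⟩ := k
  by_cases h : k < m
  · simp only [full_of_lt a _ h]; fun_prop
  · obtain rfl : k = m := by omega
    simp only [full_last]; exact contDiffAt_const

theorem contDiffAt_factor {m : ℕ} (p : ℕ) (a : ℂ) {α : Fin m → ℂ} (hα : ∀ k, ‖α k‖ < 1)
    (i j : Fin (m + 1)) : ContDiffAt ℝ ∞ (fun β : Fin m → ℂ => factor p (full a β) i j) α := by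
  have hr : ∀ k : Fin (m + 1), k.val + 1 < m + 1 →
      ContDiffAt ℝ ∞ (fun β : Fin m → ℂ => (rho (full a β k) : ℂ)) α := fun k hk =>
    Complex.ofRealCLM.contDiff.contDiffAt.comp α
      (ContDiffAt.comp (g := rho) α (contDiffAt_rho (norm_full_lt a hα k hk))
        (contDiffAt_full a α k))
  simp only [factor, of_apply]
  split_ifs with h1 h2 h3 h4 h5
  · exact (Complex.conjCLE : ℂ →L[ℝ] ℂ).contDiff.contDiffAt.comp α (contDiffAt_full a α i)
  · exact contDiffAt_const
  · exact (contDiffAt_full a α _).neg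
  · exact hr i (by omega)
  · exact hr j (by omega)
  · exact contDiffAt_const

theorem contDiffAt_cmvAt {m : ℕ} (a : ℂ) {α : Fin m → ℂ} (hα : ∀ k, ‖α k‖ < 1) :
    ContDiffAt ℝ ∞ (cmvAt a) α := by
  refine contDiffAt_matrix fun i j => ?_
  simp only [cmvAt, cmv, Matrix.mul_apply]
  exact ContDiffAt.sum fun l _ =>
    (contDiffAt_factor 0 a hα i l).mul (contDiffAt_factor 1 a hα l j)

/-- Smoothness is known beforehand, so the derivative can be read off along lines. -/
theorem fderiv_cmvAt {m : ℕ} (a : ℂ) {α : Fin m → ℂ} (hα : ∀ k, ‖α k‖ < 1) (v : Fin m → ℂ) :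
    fderiv ℝ (cmvAt a) α v = dcmv (full a α) (full 0 v) := by
  have hd := ((contDiffAt_cmvAt a hα).differentiableAt (by simp)).hasFDerivAt
  have hline : HasDerivAt (fun t : ℝ => α + t • v) v 0 := by
    have := ((hasDerivAt_id (0 : ℝ)).smul_const v).const_add α
    rw [one_smul] at this
    exact this
  have h1 : HasDerivAt (fun t : ℝ => cmvAt a (α + t • v))
      (fderiv ℝ (cmvAt a) α v) 0 := by
    refine HasFDerivAt.comp_hasDerivAt (0 : ℝ) (f := fun t : ℝ => α + t • v)
      (l := cmvAt a) ?_ hline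
    rw [zero_smul, add_zero]
    exact hd
  have h2 : HasDerivAt (fun t : ℝ => cmvAt a (α + t • v)) (dcmv (full a α) (full 0 v)) 0 := by
    have hp := hasDerivAt_matrix_mul (hasDerivAt_factor_line 0 (full 0 v) (norm_full_lt a hα))
      (hasDerivAt_factor_line 1 (full 0 v) (norm_full_lt a hα))
    simp only [zero_smul, add_zero] at hp
    simp only [cmvAt, cmv, full_add_smul]
    exact hp
  exact h1.unique h2

theorem gdBracket_eq_alBracket {m : ℕ} {a : ℂ} (ha : ‖a‖ = 1) {α : Fin m → ℂ}
    (hα : ∀ k, ‖α k‖ < 1) {φ ψ : Matrix (Fin (m + 1)) (Fin (m + 1)) ℂ → ℝ}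
    (hφ : DifferentiableAt ℝ φ (cmvAt a α)) (hψ : DifferentiableAt ℝ ψ (cmvAt a α)) :
    gdBracket φ ψ (cmvAt a α)
      = alBracket (fun β => φ (cmvAt a β)) (fun β => ψ (cmvAt a β)) α := by
  have hd := (contDiffAt_cmvAt a hα).differentiableAt (n := ∞) (by simp)
  have hchain : ∀ {χ : Matrix (Fin (m + 1)) (Fin (m + 1)) ℂ → ℝ},
      DifferentiableAt ℝ χ (cmvAt a α) → ∀ (j : Fin m) (v : ℂ),
      fderiv ℝ (fun β => χ (cmvAt a β)) α (Pi.single j v)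
        = fderiv ℝ χ (cmvAt a α) (dcmv (full a α) (Pi.single j.castSucc v)) := by
    intro χ hχ j v
    have := fderiv_comp α hχ hd
    rw [show (fun β => χ (cmvAt a β)) = χ ∘ cmvAt a from rfl, this,
      ContinuousLinearMap.comp_apply]
    exact congrArg (fderiv ℝ χ (cmvAt a α))
      ((fderiv_cmvAt a hα _).trans (by rw [full_zero_single]))
  rw [gdBracket_eq_pairing_hamVec, pairing_grad]
  conv_lhs => rw [cmvAt, hamVec_cmv (norm_full_lt a hα) (norm_full_last ha α)]
  rw [alVec, map_sum, Fin.sum_univ_castSucc, alBracket]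
  -- The sum for the field runs over all n coefficients; the fixed last one drops out since |a| = 1.
  have hlast : rho (full a α (Fin.last m)) = 0 := by
    rw [rho, norm_full_last ha α (Fin.last m) (by simp)]; simp
  rw [hlast, zero_pow two_ne_zero, zero_smul, map_zero, add_zero]
  refine Finset.sum_congr rfl fun j _ => ?_
  have hfull : full a α j.castSucc = α j := by simp [full]
  rw [hchain hφ, hchain hφ, hchain hψ, hchain hψ, hfull]
  simp only [map_smul, map_sub, smul_eq_mul, pairing_comm (grad φ _), pairing_grad]
  rfl

/-! ### Smooth dependence of eigenvalues and masses on the matrix -/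

theorem contDiffAt_det {𝕜 E : Type*} [NontriviallyNormedField 𝕜] [NormedAddCommGroup E]
    [NormedSpace 𝕜 E] [NormedAlgebra 𝕜 ℂ] {k : WithTop ℕ∞} {n : ℕ}
    {F : E → Matrix (Fin n) (Fin n) ℂ} {x : E}
    (h : ∀ i j, ContDiffAt 𝕜 k (fun y => F y i j) x) :
    ContDiffAt 𝕜 k (fun y => (F y).det) x := by
  simp only [det_apply']
  exact ContDiffAt.sum fun σ _ => contDiffAt_const.mul (contDiffAt_prod fun i _ => h _ _)

theorem contDiffAt_adjugate {𝕜 E : Type*} [NontriviallyNormedField 𝕜] [NormedAddCommGroup E]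
    [NormedSpace 𝕜 E] [NormedAlgebra 𝕜 ℂ] {k : WithTop ℕ∞} {n : ℕ}
    {F : E → Matrix (Fin n) (Fin n) ℂ} {x : E}
    (h : ∀ i j, ContDiffAt 𝕜 k (fun y => F y i j) x) (i j : Fin n) :
    ContDiffAt 𝕜 k (fun y => (F y).adjugate i j) x := by
  simp only [adjugate_apply]
  refine contDiffAt_det fun p q => ?_
  by_cases hp : p = j
  · subst hp; simp only [updateRow_self]; exact contDiffAt_const
  · simp only [updateRow_ne hp]; exact h p q

theorem contDiffAt_smul_one_sub {𝕜 E : Type*} [NontriviallyNormedField 𝕜] [NormedAddCommGroup E]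
    [NormedSpace 𝕜 E] [NormedAlgebra 𝕜 ℂ] {k : WithTop ℕ∞} {n : ℕ} {g : E → ℂ}
    {F : E → Matrix (Fin n) (Fin n) ℂ} {x : E} (hg : ContDiffAt 𝕜 k g x)
    (hF : ContDiffAt 𝕜 k F x) (i j : Fin n) :
    ContDiffAt 𝕜 k (fun y => (g y • (1 : Matrix (Fin n) (Fin n) ℂ) - F y) i j) x := by
  simp only [Matrix.sub_apply, Matrix.smul_apply, smul_eq_mul]
  exact (hg.mul contDiffAt_const).sub (contDiffAt_pi.1 (contDiffAt_pi.1 hF i) j)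

theorem isInvertible_of_apply_one_ne {L : ℂ →L[ℂ] ℂ} (h : L 1 ≠ 0) : L.IsInvertible :=
  ⟨ContinuousLinearEquiv.unitsEquivAut ℂ (Units.mk0 (L 1) h), by ext; simp⟩

/-- A simple eigenvalue extends smoothly to nearby matrices. -/
theorem exists_smooth_eigenvalue {n : ℕ} {C : Matrix (Fin n) (Fin n) ℂ} {z d : ℂ}
    (h0 : (z • (1 : Matrix (Fin n) (Fin n) ℂ) - C).det = 0)
    (hd : HasDerivAt (fun w : ℂ => (w • (1 : Matrix (Fin n) (Fin n) ℂ) - C).det) d z)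
    (hd0 : d ≠ 0) :
    ∃ g : Matrix (Fin n) (Fin n) ℂ → ℂ, ContDiffAt ℝ ∞ g C ∧
      ∀ᶠ p in 𝓝 (C, z), (p.2 • (1 : Matrix (Fin n) (Fin n) ℂ) - p.1).det = 0 → g p.1 = p.2 := by
  set f : Matrix (Fin n) (Fin n) ℂ × ℂ → ℂ :=
    fun p => (p.2 • (1 : Matrix (Fin n) (Fin n) ℂ) - p.1).det with hf
  have hfs : ContDiffAt ℂ ∞ f (C, z) :=
    contDiffAt_det (contDiffAt_smul_one_sub contDiffAt_snd contDiffAt_fst)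
  have hn : (∞ : WithTop ℕ∞) ≠ 0 := by simp
  have hinv : (fderiv ℂ f (C, z) ∘L .inr ℂ (Matrix (Fin n) (Fin n) ℂ) ℂ).IsInvertible := by
    apply isInvertible_of_apply_one_ne
    have h1 : HasDerivAt (fun w : ℂ => f (C, w)) (fderiv ℂ f (C, z) (0, 1)) z :=
      (hfs.differentiableAt hn).hasFDerivAt.comp_hasDerivAt z
        ((hasDerivAt_const z C).prodMk (hasDerivAt_id z))
    have h2 : fderiv ℂ f (C, z) (0, 1) = d := h1.unique hd
    simpa [h2] using hd0
  refine ⟨hfs.implicitFunction hn hinv,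
    (hfs.contDiffAt_implicitFunction hn hinv).restrict_scalars ℝ, ?_⟩
  filter_upwards [hfs.eventually_apply_eq_iff_implicitFunction hn hinv] with p hp h
  exact hp.1 (h.trans h0.symm)

theorem hasDerivAt_prod_sub {n : ℕ} (ζ : Fin n → ℂ) (j : Fin n) :
    HasDerivAt (fun w : ℂ => ∏ k, (w - ζ k)) (∏ k ∈ Finset.univ.erase j, (ζ j - ζ k)) (ζ j) := by
  have h : (fun w : ℂ => ∏ k, (w - ζ k))
      = fun w => (w - ζ j) * ∏ k ∈ Finset.univ.erase j, (w - ζ k) := by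
    funext w; exact (Finset.mul_prod_erase _ (fun k => w - ζ k) (Finset.mem_univ j)).symm
  have hp : DifferentiableAt ℂ (fun w : ℂ => ∏ k ∈ Finset.univ.erase j, (w - ζ k)) (ζ j) :=
    DifferentiableAt.fun_finsetProd fun k _ => by fun_prop
  rw [h]
  refine (((hasDerivAt_id (ζ j)).sub_const (ζ j)).mul hp.hasDerivAt).congr_deriv ?_
  simp

/-- The spectral data of the CMV matrices in the domain of a labelling. -/
theorem exists_diagonalization_of_labelling {m : ℕ} {a : ℂ} (ha : ‖a‖ = 1)
    {U : Set (Matrix (Fin (m + 1)) (Fin (m + 1)) ℂ)}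
    {θ : Matrix (Fin (m + 1)) (Fin (m + 1)) ℂ → Fin (m + 1) → ℝ}
    (hθ : IsLabelling (leaf m a ∩ U) θ) {B : Matrix (Fin (m + 1)) (Fin (m + 1)) ℂ}
    (hB : B ∈ leaf m a ∩ U) :
    ∃ W : Matrix (Fin (m + 1)) (Fin (m + 1)) ℂ, W * Wᴴ = 1 ∧
      B = W * diagonal (fun j => Complex.exp (θ B j * Complex.I)) * Wᴴ ∧
      ∀ j, mass θ j B = ‖W 0 j‖ ^ 2 := by
  obtain ⟨α, hα, hBα⟩ := hB.1
  refine exists_unitary_diagonalization ?_ (hθ.injective B hB)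
    (fun j => Complex.norm_exp_ofReal_mul_I _) fun j => ?_
  · rw [hBα]; exact cmvAt_mul_conjTranspose ha hα
  · rw [← hθ.range_eq B hB]; exact ⟨j, rfl⟩

/-- Column j of W is an eigenvector, and its first entry is nonzero because e₁ is cyclic. -/
theorem mass_pos {m : ℕ} {a : ℂ} (ha : ‖a‖ = 1)
    {U : Set (Matrix (Fin (m + 1)) (Fin (m + 1)) ℂ)}
    {θ : Matrix (Fin (m + 1)) (Fin (m + 1)) ℂ → Fin (m + 1) → ℝ}
    (hθ : IsLabelling (leaf m a ∩ U) θ) {B : Matrix (Fin (m + 1)) (Fin (m + 1)) ℂ}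
    (hB : B ∈ leaf m a ∩ U) (j : Fin (m + 1)) : 0 < mass θ j B := by
  obtain ⟨W, hW, hBW, hmass⟩ := exists_diagonalization_of_labelling ha hθ hB
  obtain ⟨α, hα, hBα⟩ := hB.1
  have hW' := mul_eq_one_comm.1 hW
  rw [hmass]
  refine pow_pos (norm_pos_iff.2 ?_) 2
  have hcol : cmvAt a α *ᵥ (W *ᵥ Pi.single j 1)
      = Complex.exp (θ B j * Complex.I) • (W *ᵥ Pi.single j 1) := by
    rw [← hBα]
    conv_lhs => rw [hBW]
    rw [mulVec_mulVec, Matrix.mul_assoc, hW', Matrix.mul_one, ← mulVec_mulVec,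
      diagonal_mulVec_single, ← mulVec_smul]
    congr 1
    rw [← Pi.single_smul]; simp
  have hne : W *ᵥ Pi.single j 1 ≠ 0 := fun h => by
    have h2 := congrArg (fun x => Wᴴ *ᵥ x) h
    simp only [mulVec_mulVec, hW', one_mulVec, mulVec_zero] at h2
    simpa using congrFun h2 j
  simpa using eigenvector_zero_ne ha (Complex.exp_ne_zero _) hα hne hcol

/-- Smooth local extensions of the eigenvalues and masses to all matrices. -/
theorem exists_smooth_spectral_data {m : ℕ} {a : ℂ} (ha : ‖a‖ = 1)
    {U : Set (Matrix (Fin (m + 1)) (Fin (m + 1)) ℂ)} (hU : IsOpen U)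
    {θ : Matrix (Fin (m + 1)) (Fin (m + 1)) ℂ → Fin (m + 1) → ℝ}
    (hθ : IsLabelling (leaf m a ∩ U) θ) {C : Matrix (Fin (m + 1)) (Fin (m + 1)) ℂ}
    (hC : C ∈ leaf m a ∩ U) (j : Fin (m + 1)) :
    ∃ (g : Matrix (Fin (m + 1)) (Fin (m + 1)) ℂ → ℂ)
      (M : Matrix (Fin (m + 1)) (Fin (m + 1)) ℂ → ℝ),
      ContDiffAt ℝ ∞ g C ∧ ContDiffAt ℝ ∞ M C ∧
      ∀ᶠ B in 𝓝[leaf m a] C, g B = Complex.exp (θ B j * Complex.I) ∧ M B = mass θ j B := by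
  obtain ⟨W, hW, hCW, -⟩ := exists_diagonalization_of_labelling ha hθ hC
  set ζ : Fin (m + 1) → ℂ := fun j => Complex.exp (θ C j * Complex.I) with hζ
  have hinj : Function.Injective ζ := hθ.injective C hC
  have hdet := det_smul_one_sub hW hCW
  have hder : HasDerivAt (fun w : ℂ => (w • (1 : Matrix (Fin (m + 1)) (Fin (m + 1)) ℂ) - C).det)
      (∏ k ∈ Finset.univ.erase j, (ζ j - ζ k)) (ζ j) := by
    simp only [hdet]; exact hasDerivAt_prod_sub ζ j
  have hp : ∏ k ∈ Finset.univ.erase j, (ζ j - ζ k) ≠ 0 :=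
    Finset.prod_ne_zero_iff.2 fun k hk => sub_ne_zero.2 (hinj.ne (Finset.ne_of_mem_erase hk).symm)
  have h0 : (ζ j • (1 : Matrix (Fin (m + 1)) (Fin (m + 1)) ℂ) - C).det = 0 := by
    rw [hdet]; exact Finset.prod_eq_zero (Finset.mem_univ j) (sub_self _)
  obtain ⟨g, hg, hgev⟩ := exists_smooth_eigenvalue h0 hder hp
  have hmemU : ∀ᶠ B in 𝓝[leaf m a] C, B ∈ leaf m a ∩ U := by
    filter_upwards [self_mem_nhdsWithin, nhdsWithin_le_nhds (hU.mem_nhds hC.2)] with B h1 h2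
    exact ⟨h1, h2⟩
  -- Continuity of θ brings (B, e^{iθ_j(B)}) into the neighbourhood where the implicit function
  -- gives the only root, so g follows the chosen label.
  have hevg : ∀ᶠ B in 𝓝[leaf m a] C, g B = Complex.exp (θ B j * Complex.I) := by
    have hle : 𝓝[leaf m a] C ≤ 𝓝[leaf m a ∩ U] C :=
      le_inf nhdsWithin_le_nhds (Filter.le_principal_iff.2 hmemU)
    have hθc : Filter.Tendsto (fun B => θ B j) (𝓝[leaf m a] C) (𝓝 (θ C j)) :=
      ((tendsto_pi_nhds.1 (hθ.continuousOn C hC).tendsto) j).mono_left hle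
    have hexp : Filter.Tendsto (fun B => Complex.exp (θ B j * Complex.I)) (𝓝[leaf m a] C)
        (𝓝 (ζ j)) := by
      have hcont : Continuous fun x : ℝ => Complex.exp (x * Complex.I) := by fun_prop
      exact (hcont.tendsto (θ C j)).comp hθc
    have hpair : Filter.Tendsto (fun B => (B, Complex.exp (θ B j * Complex.I))) (𝓝[leaf m a] C)
        (𝓝 (C, ζ j)) := (Filter.tendsto_id.mono_left nhdsWithin_le_nhds).prodMk_nhds hexp
    filter_upwards [hpair.eventually hgev, hmemU] with B hB hBU
    obtain ⟨W', hW', hBW', -⟩ := exists_diagonalization_of_labelling ha hθ hBU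
    refine hB ?_
    rw [det_smul_one_sub hW' hBW']
    exact Finset.prod_eq_zero (Finset.mem_univ j) (sub_self _)
  have hgC : g C = ζ j := by
    exact hevg.self_of_nhdsWithin hC.1
  -- Off the manifold the adjugate quotient need not be real; on it the real part changes nothing.
  refine ⟨g, fun B => ((g B • (1 : Matrix (Fin (m + 1)) (Fin (m + 1)) ℂ) - B).adjugate 0 0
    / (g B • (1 : Matrix (Fin (m + 1)) (Fin (m + 1)) ℂ) - B).adjugate.trace).re, hg, ?_, ?_⟩
  · have hadj := contDiffAt_adjugate (contDiffAt_smul_one_sub hg contDiffAt_id)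
    have htr : ContDiffAt ℝ ∞
        (fun B => (g B • (1 : Matrix (Fin (m + 1)) (Fin (m + 1)) ℂ) - B).adjugate.trace) C :=
      ContDiffAt.sum fun i _ => hadj i i
    have hne : (g C • (1 : Matrix (Fin (m + 1)) (Fin (m + 1)) ℂ) - C).adjugate.trace ≠ 0 := by
      rw [hgC]; exact (norm_sq_eq_adjugate_div_trace hinj hW hCW j).1
    simp only [div_eq_mul_inv]
    exact Complex.reCLM.contDiff.contDiffAt.comp C ((hadj 0 0).mul (htr.inv hne))
  · filter_upwards [hevg, hmemU] with B hB hBU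
    obtain ⟨W', hW', hBW', hm⟩ := exists_diagonalization_of_labelling ha hθ hBU
    refine ⟨hB, ?_⟩
    rw [hB, ← (norm_sq_eq_adjugate_div_trace (hθ.injective B hBU) hW' hBW' j).2, hm,
      Complex.ofReal_re]

/-- The Cauchy transform of the spectral measure in terms of the Schur function. -/
theorem schurFrom_eq_cauchy {m : ℕ} {a : ℂ} (ha : ‖a‖ = 1)
    {U : Set (Matrix (Fin (m + 1)) (Fin (m + 1)) ℂ)}
    {θ : Matrix (Fin (m + 1)) (Fin (m + 1)) ℂ → Fin (m + 1) → ℝ}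
    (hθ : IsLabelling (leaf m a ∩ U) θ) {β : Fin m → ℂ} (hβ : ∀ k, ‖β k‖ < 1)
    (hβU : cmvAt a β ∈ U) {z : ℂ} (hz : ‖z‖ < 1) :
    schurFrom a z β 0 = (1 - z * schurFrom a z β 0)
      * cauchy (fun j => (mass θ j (cmvAt a β) : ℂ))
        (fun j => Complex.exp (θ (cmvAt a β) j * Complex.I)) z := by
  obtain ⟨W, hW, hBW, hm⟩ := exists_diagonalization_of_labelling ha hθ
    (B := cmvAt a β) ⟨⟨β, hβ, rfl⟩, hβU⟩
  obtain ⟨y, hy0, hy⟩ := exists_cmvAt_mulVec_sub ha hz hβ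
  have := apply_zero_eq_cauchy hW hBW
    (fun j => ne_of_norm_lt (Complex.norm_exp_ofReal_mul_I _) hz) hy
  simp only [hm]
  rw [← this, hy0]

end

end CMV

namespace CMV

noncomputable section

/-! ### Brackets of the masses -/

theorem tendsto_cmvAt_leaf {m : ℕ} (a : ℂ) {α : Fin m → ℂ} (hα : ∀ k, ‖α k‖ < 1) :
    Filter.Tendsto (cmvAt a) (𝓝 α) (𝓝[leaf m a] cmvAt a α) := by
  refine tendsto_nhdsWithin_iff.2 ⟨(contDiffAt_cmvAt a hα).continuousAt, ?_⟩
  have h : ∀ᶠ β : Fin m → ℂ in 𝓝 α, ∀ k, ‖β k‖ < 1 :=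
    Filter.eventually_all.2 fun k =>
      (continuous_norm.comp (continuous_apply k)).continuousAt.eventually_lt_const (hα k)
  filter_upwards [h] with β hβ using ⟨β, hβ, rfl⟩

theorem hasFDerivAt_cauchy {ι E : Type*} [Fintype ι] [NormedAddCommGroup E] [NormedSpace ℝ E]
    {x : E} {μ ζ : E → ι → ℂ} {dμ dζ : ι → E →L[ℝ] ℂ} {z : ℂ}
    (hμ : ∀ j, HasFDerivAt (fun y => μ y j) (dμ j) x)
    (hζ : ∀ j, HasFDerivAt (fun y => ζ y j) (dζ j) x) (hz : ∀ j, ζ x j - z ≠ 0) :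
    HasFDerivAt (fun y => cauchy (μ y) (ζ y) z) (dcauchy (μ x) (ζ x) dμ dζ z) x :=
  HasFDerivAt.fun_sum fun j _ => hasFDerivAt_complex_div (hμ j) ((hζ j).sub_const z) (hz j)

theorem hasFDerivAt_div_one_sub {E : Type*} [NormedAddCommGroup E] [NormedSpace ℝ E]
    {x : E} {f : E → ℂ} {D : E →L[ℝ] ℂ} {z : ℂ} (hf : HasFDerivAt f D x)
    (h0 : 1 - z * f x ≠ 0) :
    HasFDerivAt (fun y => f y / (1 - z * f y)) ((1 / (1 - z * f x) ^ 2) • D) x := by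
  refine (hasFDerivAt_complex_div hf ((hf.const_mul z).const_sub 1) h0).congr_fderiv ?_
  ext v
  simp
  field_simp
  ring

/-- Transports the bracket through f ↦ G = f/(1 - z f), for which dG = df/(1 - z f)². The right side
is arranged for the pole extraction. -/
theorem alForm_cauchy_identity {z w f g : ℂ} (hzw : z ≠ w) (hf : 1 - z * f ≠ 0)
    (hg : 1 - w * g ≠ 0) :
    1 / (1 - z * f) ^ 2 * (1 / (1 - w * g) ^ 2
        * (-2 * Complex.I * ((f - g) * (z * f - w * g) / (z - w))))
      = -2 * Complex.I * ((z * (f / (1 - z * f)) - w * (g / (1 - w * g)))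
        * ((f / (1 - z * f) - g / (1 - w * g)) / (z - w)
          - f / (1 - z * f) * (g / (1 - w * g)))) := by
  have : z - w ≠ 0 := sub_ne_zero.2 hzw
  field_simp
  ring

/-- Brackets of smooth extensions of the masses. -/
theorem alForm_mass {m : ℕ} {a : ℂ} (ha : ‖a‖ = 1)
    {U : Set (Matrix (Fin (m + 1)) (Fin (m + 1)) ℂ)} (hU : IsOpen U)
    {θ : Matrix (Fin (m + 1)) (Fin (m + 1)) ℂ → Fin (m + 1) → ℝ}
    (hθ : IsLabelling (leaf m a ∩ U) θ) {α : Fin m → ℂ} (hα : ∀ k, ‖α k‖ < 1)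
    (hαU : cmvAt a α ∈ U) {ζ : (Fin m → ℂ) → Fin (m + 1) → ℂ} {μ : (Fin m → ℂ) → Fin (m + 1) → ℂ}
    {dμ dζ : Fin (m + 1) → (Fin m → ℂ) →L[ℝ] ℂ}
    (hμ : ∀ j, HasFDerivAt (fun β => μ β j) (dμ j) α)
    (hζ : ∀ j, HasFDerivAt (fun β => ζ β j) (dζ j) α)
    (hev : ∀ᶠ β in 𝓝 α, ∀ j, ζ β j = Complex.exp (θ (cmvAt a β) j * Complex.I) ∧
      μ β j = mass θ j (cmvAt a β)) {j k : Fin (m + 1)} (hjk : j ≠ k) :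
    alForm α (dμ j) (dμ k) = 2 * Complex.I * μ α j * μ α k * ((ζ α j + ζ α k) / (ζ α j - ζ α k)
      + cauchyGauge (μ α) (ζ α) j - cauchyGauge (μ α) (ζ α) k) := by
  have hα0 := hev.self_of_nhds
  have hζα : ζ α = fun j => Complex.exp (θ (cmvAt a α) j * Complex.I) :=
    funext fun j => (hα0 j).1
  have hinj : Function.Injective (ζ α) := by
    rw [hζα]; exact hθ.injective _ ⟨⟨α, hα, rfl⟩, hαU⟩
  have hnorm : ∀ j, ‖ζ α j‖ = 1 := fun j => by
    rw [hζα]; exact Complex.norm_exp_ofReal_mul_I _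
  have hden : ∀ {β : Fin m → ℂ}, (∀ k, ‖β k‖ < 1) → ∀ z, ‖z‖ < 1 →
      1 - z * schurFrom a z β 0 ≠ 0 := fun {β} hβ z hz h => by
    have h1 := norm_schurIter_le ha hz hβ (m - 0)
    have h2 : ‖z‖ * ‖schurFrom a z β 0‖ = 1 := by
      rw [← norm_mul, ← sub_eq_zero.1 h, norm_one]
    rw [schurFrom] at h2
    nlinarith [norm_nonneg z, norm_nonneg (schurIter a z β (m - 0))]
  have hpt : ∀ z, ‖z‖ < 1 → ∀ᶠ β in 𝓝 α,
      schurFrom a z β 0 / (1 - z * schurFrom a z β 0) = cauchy (μ β) (ζ β) z := fun z hz => by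
    have hUev : ∀ᶠ β in 𝓝 α, cmvAt a β ∈ U :=
      (contDiffAt_cmvAt a hα).continuousAt.eventually (hU.mem_nhds hαU)
    have hball : ∀ᶠ β : Fin m → ℂ in 𝓝 α, ∀ k, ‖β k‖ < 1 :=
      Filter.eventually_all.2 fun k =>
        (continuous_norm.comp (continuous_apply k)).continuousAt.eventually_lt_const (hα k)
    filter_upwards [hUev, hball, hev] with β h1 h2 h3
    rw [div_eq_iff (hden h2 z hz), mul_comm, show μ β = fun j => (mass θ j (cmvAt a β) : ℂ) from
      funext fun j => (h3 j).2, show ζ β = fun j => Complex.exp (θ (cmvAt a β) j * Complex.I) from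
      funext fun j => (h3 j).1]
    exact schurFrom_eq_cauchy ha hθ h2 h1 hz
  have hS := alForm_schurIter ha hα (le_refl m)
  -- The same function of the coefficients is differentiated twice, through the spectral data and
  -- through the Schur function.
  have hD : ∀ z, ‖z‖ < 1 → dcauchy (μ α) (ζ α) dμ dζ z
      = (1 / (1 - z * schurFrom a z α 0) ^ 2) • fderiv ℝ (fun β => schurIter a z β m) α :=
    fun z hz => by
      have h1 := hasFDerivAt_cauchy hμ hζ fun j => ne_of_norm_lt (hnorm j) hz
      have h2 : HasFDerivAt (fun β => schurFrom a z β 0 / (1 - z * schurFrom a z β 0)) _ α :=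
        hasFDerivAt_div_one_sub (hS.1 z hz).1.hasFDerivAt (hden hα z hz)
      exact h1.unique (h2.congr_of_eventuallyEq ((hpt z hz).mono fun β h => h.symm))
  refine form_dmu_dmu (B := alForm α) (dζ := dζ) hinj hnorm (fun z w hz hw => ?_) hjk
  rcases eq_or_ne z w with rfl | hzw
  -- On the diagonal z = w both sides vanish, whatever value the quotient by z - w takes.
  · rw [alForm_self, sub_self, zero_mul, mul_zero]
  · rw [hD z hz, hD w hw, map_smul, map_smul, LinearMap.smul_apply, smul_eq_mul, smul_eq_mul,
      hS.2 z w hz hw hzw, ← (hpt z hz).self_of_nhds, ← (hpt w hw).self_of_nhds]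
    rw [← alForm_cauchy_identity hzw (hden hα z hz) (hden hα w hw)]
    simp only [schurFrom, Nat.sub_zero]
    ring

/-! ### From the masses to the log-ratios -/

theorem I_mul_cot {s t : ℝ} (h : Complex.exp (s * Complex.I) ≠ Complex.exp (t * Complex.I)) :
    Complex.I * ((Complex.exp (s * Complex.I) + Complex.exp (t * Complex.I))
      / (Complex.exp (s * Complex.I) - Complex.exp (t * Complex.I)))
      = (Real.cot ((s - t) / 2) : ℂ) := by
  rw [Complex.ofReal_cot, Complex.cot_eq_exp_ratio]
  have e : Complex.exp (2 * Complex.I * (((s - t) / 2 : ℝ) : ℂ))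
      = Complex.exp (s * Complex.I) / Complex.exp (t * Complex.I) := by
    rw [← Complex.exp_sub]; congr 1; push_cast; ring
  rw [e]
  have ht := Complex.exp_ne_zero (t * Complex.I)
  have h1 : Complex.exp (s * Complex.I) - Complex.exp (t * Complex.I) ≠ 0 := sub_ne_zero.2 h
  have h2 : Complex.exp (t * Complex.I) - Complex.exp (s * Complex.I) ≠ 0 :=
    sub_ne_zero.2 h.symm
  have h3 : 1 - Complex.exp (s * Complex.I) / Complex.exp (t * Complex.I) ≠ 0 := by
    rw [sub_ne_zero, ne_eq, eq_div_iff ht, one_mul]; exact fun e => h e.symm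
  rw [eq_div_iff (mul_ne_zero Complex.I_ne_zero h3)]
  generalize Complex.exp (s * Complex.I) = x at *
  generalize Complex.exp (t * Complex.I) = y at *
  field_simp
  linear_combination (x + y) * (y - x) * Complex.I_sq

theorem ofReal_alBracket {m : ℕ} {f g : (Fin m → ℂ) → ℝ} {α : Fin m → ℂ} :
    (alBracket f g α : ℂ) = alForm α (Complex.ofRealCLM.comp (fderiv ℝ f α))
      (Complex.ofRealCLM.comp (fderiv ℝ g α)) := by
  rw [alBracket, alForm_apply]
  push_cast
  rfl

theorem ofRealCLM_comp_fderiv_log_div {E : Type*} [NormedAddCommGroup E] [NormedSpace ℝ E] {x : E}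
    {f g : E → ℝ} (hf : DifferentiableAt ℝ f x) (hg : DifferentiableAt ℝ g x) (hf0 : 0 < f x)
    (hg0 : 0 < g x) :
    Complex.ofRealCLM.comp (fderiv ℝ (fun y => Real.log (f y / g y)) x)
      = (1 / (f x : ℂ)) • Complex.ofRealCLM.comp (fderiv ℝ f x)
        - (1 / (g x : ℂ)) • Complex.ofRealCLM.comp (fderiv ℝ g x) := by
  have e : (fun y => Real.log (f y / g y)) =ᶠ[𝓝 x] fun y => Real.log (f y) - Real.log (g y) := by
    filter_upwards [hf.continuousAt.eventually_ne hf0.ne', hg.continuousAt.eventually_ne hg0.ne']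
      with y h1 h2 using Real.log_div h1 h2
  have h := (hf.hasFDerivAt.log hf0.ne').sub (hg.hasFDerivAt.log hg0.ne')
  rw [(h.congr_of_eventuallyEq e).fderiv]
  ext v
  simp

theorem alBracket_congr {m : ℕ} {f f' g g' : (Fin m → ℂ) → ℝ} {α : Fin m → ℂ}
    (hf : f =ᶠ[𝓝 α] f') (hg : g =ᶠ[𝓝 α] g') : alBracket f g α = alBracket f' g' α := by
  rw [alBracket, alBracket, hf.fderiv_eq, hg.fderiv_eq]

/-- The bracket of two log-ratios, given the brackets of the masses. -/
theorem alBracket_log_div {m : ℕ} {α : Fin m → ℂ} {μ₁ μ₂ μ₃ : (Fin m → ℂ) → ℝ}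
    (h₁ : DifferentiableAt ℝ μ₁ α) (h₂ : DifferentiableAt ℝ μ₂ α) (h₃ : DifferentiableAt ℝ μ₃ α)
    (p₁ : 0 < μ₁ α) (p₂ : 0 < μ₂ α) (p₃ : 0 < μ₃ α) {c₁₂ c₂₃ c₁₃ κ₁ κ₂ κ₃ : ℂ}
    (e₁₂ : alForm α (Complex.ofRealCLM.comp (fderiv ℝ μ₁ α))
      (Complex.ofRealCLM.comp (fderiv ℝ μ₂ α)) = 2 * μ₁ α * μ₂ α * (c₁₂ + κ₁ - κ₂))
    (e₂₃ : alForm α (Complex.ofRealCLM.comp (fderiv ℝ μ₂ α))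
      (Complex.ofRealCLM.comp (fderiv ℝ μ₃ α)) = 2 * μ₂ α * μ₃ α * (c₂₃ + κ₂ - κ₃))
    (e₁₃ : alForm α (Complex.ofRealCLM.comp (fderiv ℝ μ₁ α))
      (Complex.ofRealCLM.comp (fderiv ℝ μ₃ α)) = 2 * μ₁ α * μ₃ α * (c₁₃ + κ₁ - κ₃)) :
    (alBracket (fun β => Real.log (μ₂ β / μ₁ β)) (fun β => Real.log (μ₃ β / μ₁ β)) α : ℂ)
      = 2 * c₁₂ + 2 * c₂₃ - 2 * c₁₃ := by
  have n₁ : (μ₁ α : ℂ) ≠ 0 := by exact_mod_cast p₁.ne'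
  have n₂ : (μ₂ α : ℂ) ≠ 0 := by exact_mod_cast p₂.ne'
  have n₃ : (μ₃ α : ℂ) ≠ 0 := by exact_mod_cast p₃.ne'
  rw [ofReal_alBracket, ofRealCLM_comp_fderiv_log_div h₂ h₁ p₂ p₁,
    ofRealCLM_comp_fderiv_log_div h₃ h₁ p₃ p₁]
  simp only [map_sub, map_smul, LinearMap.sub_apply, LinearMap.smul_apply, smul_eq_mul, alForm_self]
  rw [alForm_swap α (Complex.ofRealCLM.comp (fderiv ℝ μ₁ α))
    (Complex.ofRealCLM.comp (fderiv ℝ μ₂ α)), e₁₂, e₂₃, e₁₃]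
  -- After division by the masses the κ add up to (κ₁ - κ₂) + (κ₂ - κ₃) - (κ₁ - κ₃) = 0.
  field_simp
  ring

end

end CMV

/-- The masses are positive, and `{log (μ₂/μ₁), log (μ₃/μ₁)}` is given by the stated formula both
in the Ablowitz–Ladik bracket, for the functions of `α₀, …, α_{n-2}`, and in the Gelfand–Dikij
bracket, for any extensions of the two functions from the manifold of CMV matrices with fixed
determinant to the space of all matrices (smooth ones exist). Here `n = m + 1`. -/
theorem propositionP (m : ℕ) (a : ℂ) (ha : ‖a‖ = 1)
    (U : Set (Matrix (Fin (m + 1)) (Fin (m + 1)) ℂ)) (hU : IsOpen U)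
    (θ : Matrix (Fin (m + 1)) (Fin (m + 1)) ℂ → Fin (m + 1) → ℝ)
    (hθ : CMV.IsLabelling (CMV.leaf m a ∩ U) θ)
    (i₁ i₂ i₃ : Fin (m + 1)) (h₁₂ : i₁ ≠ i₂) (h₂₃ : i₂ ≠ i₃) (h₁₃ : i₁ ≠ i₃)
    (α : Fin m → ℂ) (hα : ∀ k, ‖α k‖ < 1) (hαU : CMV.cmvAt a α ∈ U)
    (C : Matrix (Fin (m + 1)) (Fin (m + 1)) ℂ) (hC : C = CMV.cmvAt a α)
    (Ψ : ℝ)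
    (hΨ : Ψ = 2 * Real.cot ((θ C i₁ - θ C i₂) / 2) + 2 * Real.cot ((θ C i₂ - θ C i₃) / 2)
      + 2 * Real.cot ((θ C i₃ - θ C i₁) / 2)) :
    (∀ j, 0 < CMV.mass θ j C) ∧
    (ContDiffAt ℝ ∞ (fun β => CMV.logRatio θ i₂ i₁ (CMV.cmvAt a β)) α ∧
      ContDiffAt ℝ ∞ (fun β => CMV.logRatio θ i₃ i₁ (CMV.cmvAt a β)) α ∧
      CMV.alBracket (fun β => CMV.logRatio θ i₂ i₁ (CMV.cmvAt a β))
        (fun β => CMV.logRatio θ i₃ i₁ (CMV.cmvAt a β)) α = Ψ) ∧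
    ((∃ φ ψ : Matrix (Fin (m + 1)) (Fin (m + 1)) ℂ → ℝ,
        ContDiffAt ℝ ∞ φ C ∧ ContDiffAt ℝ ∞ ψ C ∧
        CMV.ExtendsNear (CMV.leaf m a) (CMV.logRatio θ i₂ i₁) φ C ∧
        CMV.ExtendsNear (CMV.leaf m a) (CMV.logRatio θ i₃ i₁) ψ C) ∧
      ∀ φ ψ : Matrix (Fin (m + 1)) (Fin (m + 1)) ℂ → ℝ,
        DifferentiableAt ℝ φ C → DifferentiableAt ℝ ψ C →
        CMV.ExtendsNear (CMV.leaf m a) (CMV.logRatio θ i₂ i₁) φ C →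
        CMV.ExtendsNear (CMV.leaf m a) (CMV.logRatio θ i₃ i₁) ψ C →
        CMV.gdBracket φ ψ C = Ψ) := by
  subst hC
  have hmem : CMV.cmvAt a α ∈ CMV.leaf m a ∩ U := ⟨⟨α, hα, rfl⟩, hαU⟩
  have hpos := CMV.mass_pos ha hθ hmem
  choose g M hg hM hgM using CMV.exists_smooth_spectral_data ha hU hθ hmem
  have hevB := Filter.eventually_all.2 hgM
  have hev := (CMV.tendsto_cmvAt_leaf a hα).eventually hevB
  have hMC : ∀ j, M j (CMV.cmvAt a α) = CMV.mass θ j (CMV.cmvAt a α) := fun j =>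
    (hev.self_of_nhds j).2
  have hMpos : ∀ j, 0 < M j (CMV.cmvAt a α) := fun j => by rw [hMC]; exact hpos j
  have hinj := hθ.injective _ hmem
  have hcmv := CMV.contDiffAt_cmvAt a hα
  have hsmooth : ∀ i k, ContDiffAt ℝ ∞ (fun B => Real.log (M i B / M k B)) (CMV.cmvAt a α) :=
    fun i k => ((hM i).div (hM k) (hMpos k).ne').log (div_pos (hMpos i) (hMpos k)).ne'
  have hext : ∀ i k, CMV.ExtendsNear (CMV.leaf m a) (CMV.logRatio θ i k)
      (fun B => Real.log (M i B / M k B)) (CMV.cmvAt a α) := fun i k =>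
    hevB.mono fun B hB => by simp only [CMV.logRatio, (hB i).2, (hB k).2]
  have hlog : ∀ i k, (fun β => CMV.logRatio θ i k (CMV.cmvAt a β)) =ᶠ[𝓝 α]
      fun β => Real.log (M i (CMV.cmvAt a β) / M k (CMV.cmvAt a β)) := fun i k =>
    hev.mono fun β hβ => by simp only [CMV.logRatio, (hβ i).2, (hβ k).2]
  have hMd : ∀ j, DifferentiableAt ℝ (fun β => M j (CMV.cmvAt a β)) α := fun j =>
    ((hM j).comp α hcmv).differentiableAt (by simp)
  have hgd : ∀ j, DifferentiableAt ℝ (fun β => g j (CMV.cmvAt a β)) α := fun j =>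
    ((hg j).comp α hcmv).differentiableAt (by simp)
  have hal : CMV.alBracket (fun β => CMV.logRatio θ i₂ i₁ (CMV.cmvAt a β))
      (fun β => CMV.logRatio θ i₃ i₁ (CMV.cmvAt a β)) α = Ψ := by
    have hform : ∀ {j k}, j ≠ k → _ := fun {j k} hjk => CMV.alForm_mass ha hU hθ hα hαU
      (ζ := fun β j => g j (CMV.cmvAt a β)) (μ := fun β j => (M j (CMV.cmvAt a β) : ℂ))
      (dμ := fun j => Complex.ofRealCLM.comp (fderiv ℝ (fun β => M j (CMV.cmvAt a β)) α))
      (fun j => Complex.ofRealCLM.hasFDerivAt.comp α (hMd j).hasFDerivAt)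
      (fun j => (hgd j).hasFDerivAt)
      (hev.mono fun β hβ j => ⟨(hβ j).1, by rw [(hβ j).2]⟩) (j := j) (k := k) hjk
    have hcot : ∀ {j k}, j ≠ k → Complex.I * ((g j (CMV.cmvAt a α) + g k (CMV.cmvAt a α))
        / (g j (CMV.cmvAt a α) - g k (CMV.cmvAt a α)))
        = (Real.cot ((θ (CMV.cmvAt a α) j - θ (CMV.cmvAt a α) k) / 2) : ℂ) := fun {j k} hjk => by
      rw [(hev.self_of_nhds j).1, (hev.self_of_nhds k).1]
      exact CMV.I_mul_cot (hinj.ne hjk)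
    rw [CMV.alBracket_congr (hlog i₂ i₁) (hlog i₃ i₁), hΨ]
    set κ : Fin (m + 1) → ℂ := fun j => Complex.I * CMV.cauchyGauge
      (fun j => (M j (CMV.cmvAt a α) : ℂ)) (fun j => g j (CMV.cmvAt a α)) j with hκ
    have hbr : ∀ {j k}, j ≠ k →
        CMV.alForm α (Complex.ofRealCLM.comp (fderiv ℝ (fun β => M j (CMV.cmvAt a β)) α))
          (Complex.ofRealCLM.comp (fderiv ℝ (fun β => M k (CMV.cmvAt a β)) α))
        = 2 * M j (CMV.cmvAt a α) * M k (CMV.cmvAt a α)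
          * ((Real.cot ((θ (CMV.cmvAt a α) j - θ (CMV.cmvAt a α) k) / 2) : ℂ) + κ j - κ k) :=
      fun hjk => (hform hjk).trans (by rw [← hcot hjk, hκ]; ring)
    have key := CMV.alBracket_log_div (hMd i₁) (hMd i₂) (hMd i₃) (hMpos i₁) (hMpos i₂) (hMpos i₃)
      (hbr h₁₂) (hbr h₂₃) (hbr h₁₃)
    -- Oddness of the cotangent makes the last term cyclic.
    have hneg : Real.cot ((θ (CMV.cmvAt a α) i₃ - θ (CMV.cmvAt a α) i₁) / 2)
        = -Real.cot ((θ (CMV.cmvAt a α) i₁ - θ (CMV.cmvAt a α) i₃) / 2) := by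
      rw [← neg_sub, neg_div, Real.cot_eq_cos_div_sin, Real.cot_eq_cos_div_sin, Real.cos_neg,
        Real.sin_neg, div_neg]
    rw [hneg]
    have := Complex.ofReal_injective (key.trans (by push_cast; rfl :
      _ = ((2 * Real.cot ((θ (CMV.cmvAt a α) i₁ - θ (CMV.cmvAt a α) i₂) / 2)
        + 2 * Real.cot ((θ (CMV.cmvAt a α) i₂ - θ (CMV.cmvAt a α) i₃) / 2)
        - 2 * Real.cot ((θ (CMV.cmvAt a α) i₁ - θ (CMV.cmvAt a α) i₃) / 2) : ℝ) : ℂ)))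
    rw [this]
    ring
  refine ⟨hpos, ⟨?_, ?_, hal⟩, ⟨_, _, hsmooth i₂ i₁, hsmooth i₃ i₁, hext i₂ i₁, hext i₃ i₁⟩, ?_⟩
  · exact ((hsmooth i₂ i₁).comp α hcmv).congr_of_eventuallyEq (hlog i₂ i₁)
  · exact ((hsmooth i₃ i₁).comp α hcmv).congr_of_eventuallyEq (hlog i₃ i₁)
  · intro φ ψ hφ hψ eφ eψ
    -- Any extension composed with the parametrization agrees with the log-ratio near α, and the
    -- Ablowitz–Ladik bracket sees only these germs.
    rw [CMV.gdBracket_eq_alBracket ha hα hφ hψ, ← hal]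
    exact CMV.alBracket_congr ((CMV.tendsto_cmvAt_leaf a hα).eventually eφ)
      ((CMV.tendsto_cmvAt_leaf a hα).eventually eψ)
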